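/- Let $n\ge 2$ and $p<0$. Write $B_\rho(x)$ for the open ball of radius $\rho$ centered at $x\in\mathbb R^n$, $B_\rho=B_\rho(0)$, $|\cdot|$ for Lebesgue measure, and $\mathcal H^{n-1}$ for the $(n-1)$-dimensional Hausdorff measure. For a set $E\subset\mathbb R^n$ of finite perimeter let $E^{(1)}$ be the set of points at which $E$ has Lebesgue density $1$, let $\partial^*E$ be the (De Giorgi) reduced boundary of $E$, and set $$P_p(E)=\int_{\partial^*E}|x|^p\,d\mathcal H^{n-1}\in[0,\infty].$$ Let $\alpha>\max\{1,\,-p/(n-1)\}$. Then there is $\bar r>0$, depending only on $n$, $p$, $\alpha$, such that the following holds for every $r\in(0,\bar r)$ and every sequence $(p_h)_{h\ge0}$ of points of $B_1\setminus\{0\}$ that is dense in $B_1$. Put $r_i=r\,2^{-i/n}$ for $i\ge 0$, and define recursively $q_i=p_{h_i}$, where $h_i$ is the smallest index different from $h_0,\dots,h_{i-1}$ such that $|p_{h_i}|^\alpha>2^\alpha r_i$. Then the indices $h_i$ are well defined, every index is chosen exactly once, and the set $$E=\bigcup_{i=0}^\infty B_{r_i}(q_i)$$ has finite perimeter and satisfies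 $$0\in\partial E^{(1)}\setminus\partial^*E .$$ Moreover there is $R>0$ with $|E|=|B_R|$ and $$P_p(E)<P_p(B_R).$$ In particular, for $p\le 1-n$, the hypothesis $0\in\operatorname{int}(E^{(1)})$ in the isoperimetric inequality $P_p(E)\ge P_p(B_R)$, $|E|=|B_R|$, cannot be weakened to $0\in\overline{E^{(1)}}$, nor to $0\in\partial E^{(1)}\setminus\partial^*E$. -/

import Mathlib

open MeasureTheory Filter Set Metric
open scoped Topology ENNReal

noncomputable section

/-- `ℝⁿ` with its Euclidean structure. -/
abbrev Rn (n : ℕ) : Type := EuclideanSpace ℝ (Fin n)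

/-- The divergence of a vector field on `ℝⁿ`. -/
def divergence {n : ℕ} (X : Rn n → Rn n) (x : Rn n) : ℝ :=
  ∑ i : Fin n, (fderiv ℝ X x (EuclideanSpace.single i 1)) i

/-- The Euclidean perimeter: the supremum of `∫_E div X` over the compactly supported `C¹` vector
fields `X` with `|X| ≤ 1`. -/
def perimeter {n : ℕ} (E : Set (Rn n)) : ℝ≥0∞ :=
  ⨆ (X : Rn n → Rn n) (_ : ContDiff ℝ 1 X) (_ : HasCompactSupport X) (_ : ∀ x, ‖X x‖ ≤ 1),
    ENNReal.ofReal (∫ x in E, divergence X x)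

/-- A set of finite perimeter: Lebesgue measurable, with finite perimeter. -/
def HasFinitePerimeter {n : ℕ} (E : Set (Rn n)) : Prop :=
  NullMeasurableSet E (volume : Measure (Rn n)) ∧ perimeter E < ⊤

/-- `(μ, ν)` is the polar decomposition of the Gauss-Green measure of `E`: `μ` is a Radon measure,
`ν` is a Borel field of `μ`-a.e. unit vectors, and `∫_E div X = ∫ ⟨X, ν⟩ dμ` for all `X ∈ C¹_c`.
For a set of locally finite perimeter such a pair exists by the Riesz theorem; then `μ` is unique,
and `ν` is unique up to `μ`-null sets. -/
structure IsGaussGreen {n : ℕ} (E : Set (Rn n)) (μ : Measure (Rn n)) (ν : Rn n → Rn n) :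
    Prop where
  locallyFinite : IsLocallyFiniteMeasure μ
  measurable : Measurable ν
  norm_eq_one : ∀ᵐ x ∂μ, ‖ν x‖ = 1
  gauss_green : ∀ X : Rn n → Rn n, ContDiff ℝ 1 X → HasCompactSupport X →
    ∫ x in E, divergence X x = ∫ x, inner ℝ (X x) (ν x) ∂μ

/-- The reduced boundary `∂*E` (De Giorgi): the points `x` of the support of the Gauss-Green measure
at which the averages of the normal over `B_ρ(x)` converge, as `ρ → 0⁺`, to a unit vector. -/
def reducedBoundary {n : ℕ} (E : Set (Rn n)) : Set (Rn n) :=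
  {x | ∃ (μ : Measure (Rn n)) (ν : Rn n → Rn n), IsGaussGreen E μ ν ∧
    (∀ ρ : ℝ, 0 < ρ → 0 < μ (ball x ρ)) ∧
    ∃ v : Rn n, ‖v‖ = 1 ∧
      Tendsto (fun ρ : ℝ => ⨍ y in ball x ρ, ν y ∂μ) (𝓝[>] 0) (𝓝 v)}

/-- `E^{(a)}`, the set of points at which `E` has Lebesgue density `a`. -/
def densityPoints {n : ℕ} (E : Set (Rn n)) (a : ℝ) : Set (Rn n) :=
  {x | Tendsto (fun ρ : ℝ => volume.real (E ∩ ball x ρ) / volume.real (ball x ρ))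
    (𝓝[>] 0) (𝓝 a)}

/-- The weighted perimeter `P_p(E) = ∫_{∂*E} |x|^p dℋ^{n-1}`, with values in `[0, ∞]`. Here
`Measure.euclideanHausdorffMeasure (n - 1)` is `ℋ^{n-1}` in its usual normalisation. -/
def weightedPerimeter {n : ℕ} (p : ℝ) (E : Set (Rn n)) : ℝ≥0∞ :=
  ∫⁻ x in reducedBoundary E, ‖x‖ₑ ^ p ∂(Measure.euclideanHausdorffMeasure (n - 1))

/-- The radii `r_i = r / 2^{i/n}`. -/
def radius (n : ℕ) (r : ℝ) (i : ℕ) : ℝ := r / (2 : ℝ) ^ ((i : ℝ) / (n : ℝ))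

/-- The permutation `σ` is the greedy rearrangement of the sequence `c` relative to `α` and `r`:
`σ i` is the smallest index not among `σ 0, …, σ (i - 1)` such that `|c_{σ i}|^α > 2^α r_i`. -/
def IsGreedyRearrangement {n : ℕ} (α r : ℝ) (c : ℕ → Rn n) (σ : Equiv.Perm ℕ) : Prop :=
  ∀ i : ℕ, IsLeast {h : ℕ | (∀ j < i, h ≠ σ j) ∧ (2 : ℝ) ^ α * radius n r i < ‖c h‖ ^ α} (σ i)

/-- The union of the balls `B_{r_i}(q_i)`, `q_i = c_{σ i}`. -/
def ballUnion {n : ℕ} (r : ℝ) (c : ℕ → Rn n) (σ : Equiv.Perm ℕ) : Set (Rn n) :=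
  ⋃ i : ℕ, ball (c (σ i)) (radius n r i)

end

/-! The selection rule says |q_i| > 2 r_i^{1/α}. Since r_i ≤ r < 1 < α, the sphere ∂B_{r_i}(q_i)
stays at distance at least r_i^{1/α} from the origin, so its weighted area is at most C
r_i^{n-1+p/α}. The exponent β = n-1+p/α is positive because α > -p/(n-1), and the radii are
geometric, whence P_p(E) ≤ C' r^β. On the other side r ≤ R ≤ 2r gives P_p(B_R) ≥ c r^{p+n-1}. The
quotient is of order r^{p/α-p}, and p/α-p > 0 because α > 1 and p < 0; it is therefore less than 1
for small r.

At the origin: E is open and contains a sequence dense in B_1, so 0 lies in the closure of E^{(1)}.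
A ball of the family that meets B_ρ has r_i < ρ^α, and summing the geometric tail gives |E ∩ B_ρ| ≤
2|B_1|ρ^{αn} = o(ρ^n). Density zero keeps 0 out of E^{(1)}, and out of ∂*E by De Giorgi's lower
density estimate `exists_lower_density_reducedBoundary`.

The delicate point is that P_p(E) is bounded by the sum over the spheres, although the topological
boundary of E has positive volume. This is
`euclideanHausdorffMeasure_reducedBoundary_diff_iUnion_sphere`: at x ∈ ∂*E the lower density of E
forces the sum m of the surface measures of the spheres to give B_{3t}(x) mass at least c t^{n-1}
for small t; a Vitali covering (`hausdorffMeasure_le_of_frequently_le`) then bounds ℋ^{n-1} by a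
multiple of m on ∂*E minus the spheres, where m vanishes. -/

/-! ### Divergence and integration by parts. -/

theorem divergence_eq_sum_proj {n : ℕ} {X : Rn n → Rn n} (hX : Differentiable ℝ X) (x : Rn n) :
    divergence X x = ∑ i, fderiv ℝ (fun y => X y i) x (EuclideanSpace.single i 1) := by
  unfold divergence
  refine Finset.sum_congr rfl fun i _ => ?_
  have h : HasFDerivAt (fun y => X y i) ((EuclideanSpace.proj (𝕜 := ℝ) i).comp (fderiv ℝ X x)) x :=
    (EuclideanSpace.proj (𝕜 := ℝ) i).hasFDerivAt.comp x (hX x).hasFDerivAt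
  rw [h.fderiv]
  rfl

theorem map_eq_sum_single {n : ℕ} (L : Rn n →L[ℝ] ℝ) (v : Rn n) :
    L v = ∑ i, L (EuclideanSpace.single i 1) * v i := by
  conv_lhs => rw [← (EuclideanSpace.basisFun (Fin n) ℝ).sum_repr v]
  simp [mul_comm]

theorem divergence_smul_const {n : ℕ} {g : Rn n → ℝ} {x : Rn n} (hg : DifferentiableAt ℝ g x)
    (v : Rn n) : divergence (fun y => g y • v) x = fderiv ℝ g x v := by
  unfold divergence
  rw [map_eq_sum_single]
  refine Finset.sum_congr rfl fun i _ => ?_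
  rw [fderiv_smul_const hg]
  simp

theorem continuous_divergence {n : ℕ} {X : Rn n → Rn n} (hX : ContDiff ℝ 1 X) :
    Continuous (divergence X) := by
  have := hX.continuous_fderiv one_ne_zero
  unfold divergence
  fun_prop

theorem hasCompactSupport_divergence {n : ℕ} {X : Rn n → Rn n} (hX : HasCompactSupport X) :
    HasCompactSupport (divergence X) := by
  refine (hX.fderiv (𝕜 := ℝ)).mono fun x hx => ?_
  contrapose! hx
  simp only [Function.mem_support, not_not] at hx ⊢
  simp [divergence, hx]

theorem integrable_divergence {n : ℕ} {X : Rn n → Rn n} (hX : ContDiff ℝ 1 X)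
    (hc : HasCompactSupport X) : Integrable (divergence X) :=
  (continuous_divergence hX).integrable_of_hasCompactSupport (hasCompactSupport_divergence hc)

/-- Coordinatewise integration by parts, with Rademacher's theorem to identify line derivatives with
the differential. Lipschitz rather than C¹ regularity of f is needed for the radial ramps that
approximate the indicator of a ball. -/
theorem integral_mul_divergence {n : ℕ} {C : NNReal} {f : Rn n → ℝ} (hf : LipschitzWith C f)
    {X : Rn n → Rn n} (hX : ContDiff ℝ 1 X) (hc : HasCompactSupport X) :
    ∫ x, f x * divergence X x = -∫ x, fderiv ℝ f x (X x) := by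
  have hXi : ∀ i, ContDiff ℝ 1 fun y => X y i := fun i => by fun_prop
  have hci : ∀ i, HasCompactSupport fun y => X y i := fun i =>
    hc.comp_left (g := fun v : Rn n => v i) rfl
  have hLi : ∀ i, ∃ D, LipschitzWith D fun y => X y i := fun i =>
    (hXi i).lipschitzWith_of_hasCompactSupport (hci i) one_ne_zero
  have hfd := hf.ae_differentiableAt (μ := (volume : Measure (Rn n)))
  have key : ∀ i, ∫ x, f x * fderiv ℝ (fun y => X y i) x (EuclideanSpace.single i 1) =
      -∫ x, lineDeriv ℝ f x (EuclideanSpace.single i 1) * X x i := fun i => by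
    obtain ⟨D, hD⟩ := hLi i
    rw [hf.integral_lineDeriv_mul_eq hD (hci i), ← integral_neg]
    refine integral_congr_ae (Eventually.of_forall fun x => ?_)
    simp only
    rw [((hXi i).differentiable one_ne_zero x).lineDeriv_eq_fderiv]
    simp [mul_comm]
  have hint1 : ∀ i, Integrable fun x => f x * fderiv ℝ (fun y => X y i) x
      (EuclideanSpace.single i 1) := fun i => by
    refine Continuous.integrable_of_hasCompactSupport ?_ ?_
    · have := (hXi i).continuous_fderiv one_ne_zero
      have := hf.continuous
      fun_prop
    · refine HasCompactSupport.mul_left ?_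
      exact (hci i).fderiv_apply (𝕜 := ℝ) _
  have hint2 : ∀ i, Integrable fun x => lineDeriv ℝ f x (EuclideanSpace.single i 1) * X x i :=
    fun i => by
    have h1 : Integrable fun x => X x i :=
      (hXi i).continuous.integrable_of_hasCompactSupport (hci i)
    exact h1.mul_of_top_right (hf.memLp_lineDeriv _)
  simp_rw [divergence_eq_sum_proj (hX.differentiable one_ne_zero), Finset.mul_sum]
  rw [integral_finsetSum _ fun i _ => hint1 i, Finset.sum_congr rfl fun i _ => key i,
    Finset.sum_neg_distrib, ← integral_finsetSum _ fun i _ => hint2 i]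
  congr 1
  refine integral_congr_ae ?_
  filter_upwards [hfd] with x hx
  rw [map_eq_sum_single]
  exact Finset.sum_congr rfl fun i _ => by rw [hx.lineDeriv_eq_fderiv]

theorem integral_divergence_eq_zero {n : ℕ} {X : Rn n → Rn n} (hX : ContDiff ℝ 1 X)
    (hc : HasCompactSupport X) : ∫ x, divergence X x = 0 := by
  simpa using integral_mul_divergence (LipschitzWith.const (1 : ℝ)) hX hc

/-! ### Radial cutoff functions. -/

open Real in
theorem exists_deriv_smoothTransition_bound :
    ∃ K : ℝ, 0 < K ∧ ∀ x, |deriv smoothTransition x| ≤ K := by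
  obtain ⟨K, hK⟩ := (isCompact_Icc (a := (0 : ℝ)) (b := 1)).exists_bound_of_continuousOn
    ((smoothTransition.contDiff (n := 1)).continuous_deriv le_rfl).continuousOn
  refine ⟨max K 1, by positivity, fun x => ?_⟩
  by_cases hx : x ∈ Icc (0 : ℝ) 1
  · exact (hK x hx).trans (le_max_left _ _)
  · have : deriv smoothTransition x = 0 := by
      rcases le_total x 0 with h | h
      · refine IsLocalMin.deriv_eq_zero (Eventually.of_forall fun y => ?_)
        rw [smoothTransition.zero_of_nonpos h]
        exact smoothTransition.nonneg y
      · refine IsLocalMax.deriv_eq_zero (Eventually.of_forall fun y => ?_)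
        have h1 : 1 ≤ x := by
          by_contra h1
          exact hx ⟨h, by linarith⟩
        change smoothTransition y ≤ smoothTransition x
        rw [smoothTransition.one_of_one_le h1]
        exact smoothTransition.le_one y
    rw [this]
    simp

/-- A smooth radial function equal to `1` on `B_s(a)` and to `0` off `B_t(a)`. -/
noncomputable def cutoff {n : ℕ} (a : Rn n) (s t : ℝ) (y : Rn n) : ℝ :=
  Real.smoothTransition ((t ^ 2 - ‖y - a‖ ^ 2) / (t ^ 2 - s ^ 2))

section Cutoff

variable {n : ℕ} {a : Rn n} {s t : ℝ}

theorem cutoff_nonneg (y : Rn n) : 0 ≤ cutoff a s t y := Real.smoothTransition.nonneg _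

theorem cutoff_le_one (y : Rn n) : cutoff a s t y ≤ 1 := Real.smoothTransition.le_one _

theorem contDiff_cutoff {m : ℕ∞} : ContDiff ℝ m (cutoff a s t) := by
  unfold cutoff
  refine Real.smoothTransition.contDiff.comp ?_
  exact (contDiff_const.sub ((contDiff_id.sub contDiff_const).norm_sq ℝ)).div_const _

theorem sq_sub_sq_pos (hs : 0 ≤ s) (hst : s < t) : 0 < t ^ 2 - s ^ 2 := by nlinarith

theorem cutoff_eq_one (hs : 0 ≤ s) (hst : s < t) {y : Rn n} (hy : ‖y - a‖ ≤ s) :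
    cutoff a s t y = 1 := by
  refine Real.smoothTransition.one_of_one_le ?_
  rw [le_div_iff₀ (sq_sub_sq_pos hs hst)]
  nlinarith [norm_nonneg (y - a)]

theorem cutoff_eq_zero (hs : 0 ≤ s) (hst : s < t) {y : Rn n} (hy : t ≤ ‖y - a‖) :
    cutoff a s t y = 0 := by
  refine Real.smoothTransition.zero_of_nonpos (div_nonpos_of_nonpos_of_nonneg ?_ ?_)
  · nlinarith [norm_nonneg (y - a)]
  · exact (sq_sub_sq_pos hs hst).le

theorem hasCompactSupport_cutoff (hs : 0 ≤ s) (hst : s < t) : HasCompactSupport (cutoff a s t) := by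
  refine HasCompactSupport.intro (isCompact_closedBall a t) fun y hy => ?_
  rw [mem_closedBall, dist_eq_norm, not_le] at hy
  exact cutoff_eq_zero hs hst hy.le

theorem fderiv_cutoff_eq_zero (hs : 0 ≤ s) (hst : s < t) {y : Rn n}
    (hy : ‖y - a‖ ≤ s ∨ t ≤ ‖y - a‖) : fderiv ℝ (cutoff a s t) y = 0 := by
  rcases hy with h | h
  · refine IsLocalMax.fderiv_eq_zero (Eventually.of_forall fun z => ?_)
    rw [cutoff_eq_one hs hst h]
    exact cutoff_le_one z
  · refine IsLocalMin.fderiv_eq_zero (Eventually.of_forall fun z => ?_)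
    rw [cutoff_eq_zero hs hst h]
    exact cutoff_nonneg z

/-- The argument of the transition has gradient of norm 2‖y-a‖/(t²-s²), and for ‖y-a‖ < t this is at
most 2t/((t-s)(t+s)) ≤ 2/(t-s). -/
theorem norm_fderiv_cutoff_le {K : ℝ} (hK : ∀ x, |deriv Real.smoothTransition x| ≤ K)
    (hs : 0 ≤ s) (hst : s < t) (y : Rn n) : ‖fderiv ℝ (cutoff a s t) y‖ ≤ 2 * K / (t - s) := by
  have hK0 : 0 ≤ K := (abs_nonneg _).trans (hK 0)
  by_cases hy : t ≤ ‖y - a‖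
  · rw [fderiv_cutoff_eq_zero hs hst (Or.inr hy), norm_zero]
    exact div_nonneg (by linarith) (by linarith)
  push Not at hy
  have hd := sq_sub_sq_pos hs hst
  have h1 : HasFDerivAt (fun y : Rn n => (t ^ 2 - ‖y - a‖ ^ 2) / (t ^ 2 - s ^ 2))
      ((t ^ 2 - s ^ 2)⁻¹ • (-((2 : ℝ) • innerSL ℝ (y - a)) : Rn n →L[ℝ] ℝ)) y := by
    have h2 : HasFDerivAt (fun y : Rn n => ‖y - a‖ ^ 2)
        ((2 : ℝ) • innerSL ℝ (y - a) : Rn n →L[ℝ] ℝ) y := by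
      refine ((hasFDerivAt_id y).sub_const a).norm_sq.congr_fderiv ?_
      ext v
      simp
    simpa [div_eq_inv_mul] using (h2.const_sub (t ^ 2)).const_mul (t ^ 2 - s ^ 2)⁻¹
  have h3 := (((Real.smoothTransition.contDiff (n := 1)).differentiable one_ne_zero
    ((t ^ 2 - ‖y - a‖ ^ 2) / (t ^ 2 - s ^ 2))).hasDerivAt).comp_hasFDerivAt y h1
  have h4 : HasFDerivAt (cutoff a s t) _ y := h3
  rw [h4.fderiv, norm_smul, norm_smul, norm_neg, norm_inv, Real.norm_eq_abs, Real.norm_eq_abs,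
    abs_of_pos hd, norm_smul, innerSL_apply_norm]
  have h5 : (t ^ 2 - s ^ 2)⁻¹ * (‖(2 : ℝ)‖ * ‖y - a‖) ≤ 2 / (t - s) := by
    rw [inv_mul_le_iff₀ hd, mul_div_assoc', le_div_iff₀ (by linarith)]
    simp only [Real.norm_ofNat]
    nlinarith [norm_nonneg (y - a), mul_nonneg hs (by linarith : 0 ≤ t - s)]
  calc _ ≤ K * (2 / (t - s)) := mul_le_mul (hK _) h5 (by positivity) hK0
    _ = _ := by ring

end Cutoff

/-- A cutoff is a continuous nonincreasing function of the distance to its centre. This lets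
estimates known on balls pass to cutoffs by the layer cake formula. -/
theorem exists_setOf_lt_cutoff_eq_ball {n : ℕ} (a : Rn n) {s t : ℝ} (hs : 0 ≤ s) (hst : s < t)
    {τ : ℝ} (hτ : 0 ≤ τ) : ∃ ρ ≤ t, {y | τ < cutoff a s t y} = ball a ρ := by
  set f : ℝ → ℝ := fun u => Real.smoothTransition ((t ^ 2 - u ^ 2) / (t ^ 2 - s ^ 2)) with hf
  have hd := sq_sub_sq_pos hs hst
  have hcont : Continuous f := Real.smoothTransition.continuous.comp (by fun_prop)
  have hanti : ∀ u u', 0 ≤ u → u ≤ u' → f u' ≤ f u := fun u u' h0 h =>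
    Real.smoothTransition.monotone (by gcongr)
  have hft : ∀ u, t ≤ u → f u = 0 := fun u hu =>
    Real.smoothTransition.zero_of_nonpos (div_nonpos_of_nonpos_of_nonneg (by nlinarith) hd.le)
  set S : Set ℝ := {u | 0 ≤ u ∧ τ < f u} with hS
  have hSt : ∀ u ∈ S, u ≤ t := fun u hu => by
    by_contra! h
    have := hu.2
    rw [hft u h.le] at this
    linarith
  have hkey : ∀ u, 0 ≤ u → (τ < f u ↔ u < sSup S) := fun u hu => by
    constructor
    · intro h
      obtain ⟨u', h1, h2⟩ := ((hcont.continuousAt.eventually (lt_mem_nhds h)).filter_mono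
        nhdsWithin_le_nhds |>.and (self_mem_nhdsWithin (a := u) (s := Ioi u))).exists
      exact lt_of_lt_of_le h2 (le_csSup ⟨t, hSt⟩ ⟨hu.trans (le_of_lt h2), h1⟩)
    · intro h
      -- The supremum of the empty set is 0 by convention, which no u ≥ 0 is below; an empty
      -- superlevel set thus corresponds to the ball of radius 0.
      have hne : S.Nonempty := by
        by_contra! h0
        rw [h0, Real.sSup_empty] at h
        linarith
      obtain ⟨u', hu', h'⟩ := exists_lt_of_lt_csSup hne h
      exact hu'.2.trans_le (hanti u u' hu h'.le)
  refine ⟨sSup S, Real.sSup_le hSt (by linarith), ?_⟩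
  ext y
  rw [mem_ball, dist_eq_norm, ← hkey _ (norm_nonneg _)]
  rfl

/-! ### The Gauss-Green measure near a point of the reduced boundary. -/

section GaussGreen

variable {n : ℕ} {E : Set (Rn n)} {μ : Measure (Rn n)} {ν : Rn n → Rn n}

theorem IsGaussGreen.abs_inner_le (h : IsGaussGreen E μ ν) {v : Rn n} (hv : ‖v‖ = 1) :
    ∀ᵐ y ∂μ, |inner ℝ v (ν y)| ≤ 1 := by
  filter_upwards [h.norm_eq_one] with y hy
  calc _ ≤ ‖v‖ * ‖ν y‖ := abs_real_inner_le_norm _ _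
    _ = 1 := by rw [hv, hy, one_mul]

theorem IsGaussGreen.measurable_inner (h : IsGaussGreen E μ ν) (v : Rn n) :
    Measurable fun y => inner ℝ v (ν y) :=
  measurable_const.inner h.measurable

theorem IsGaussGreen.integrable_mul_inner (h : IsGaussGreen E μ ν) {v : Rn n} (hv : ‖v‖ = 1)
    {φ : Rn n → ℝ} (hφ : Integrable φ μ) : Integrable (fun y => φ y * inner ℝ v (ν y)) μ :=
  hφ.mul_bdd (c := 1) (h.measurable_inner v).aestronglyMeasurable (h.abs_inner_le hv)

theorem IsGaussGreen.integrable_of_hasCompactSupport (h : IsGaussGreen E μ ν) {φ : Rn n → ℝ}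
    (hφ : Continuous φ) (hc : HasCompactSupport φ) : Integrable φ μ :=
  have := h.locallyFinite
  hφ.integrable_of_hasCompactSupport hc

theorem IsGaussGreen.integral_mul_inner (h : IsGaussGreen E μ ν) {φ : Rn n → ℝ}
    (hφ : ContDiff ℝ 1 φ) (hc : HasCompactSupport φ) (v : Rn n) :
    ∫ y, φ y * inner ℝ v (ν y) ∂μ = ∫ y in E, fderiv ℝ φ y v := by
  have := h.gauss_green (fun y => φ y • v) (by fun_prop) (hc.smul_right)
  rw [← integral_congr_ae (Eventually.of_forall fun y =>
    divergence_smul_const (hφ.differentiable one_ne_zero y) v), this]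
  simp [real_inner_smul_left]

/-- Layer cake: the superlevel sets of the cutoff are balls, where the inequality is assumed. As
⟨v,ν⟩ may be negative, the comparison is made with the nonnegative density 1+⟨v,ν⟩, which turns the
factor 1/2 into 3/2. -/
theorem IsGaussGreen.integral_cutoff_le_two_mul (h : IsGaussGreen E μ ν) {x v : Rn n} (hv : ‖v‖ = 1)
    {t₀ : ℝ} (hball : ∀ ρ, 0 < ρ → ρ ≤ t₀ →
      μ.real (ball x ρ) ≤ 2 * ∫ y in ball x ρ, inner ℝ v (ν y) ∂μ)
    {s t : ℝ} (hs : 0 ≤ s) (hst : s < t) (ht : t ≤ t₀) :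
    ∫ y, cutoff x s t y ∂μ ≤ 2 * ∫ y, cutoff x s t y * inner ℝ v (ν y) ∂μ := by
  have := h.locallyFinite
  set φ := cutoff x s t with hφ
  set g : Rn n → ℝ := fun y => 1 + inner ℝ v (ν y) with hg
  have hgm : Measurable g := measurable_const.add (h.measurable_inner v)
  have hg0 : ∀ᵐ y ∂μ, 0 ≤ g y := by
    filter_upwards [h.abs_inner_le hv] with y hy
    have := (abs_le.1 hy).1
    simp only [hg]
    linarith
  have hφi : Integrable φ μ := h.integrable_of_hasCompactSupport
    (contDiff_cutoff (m := 1)).continuous (hasCompactSupport_cutoff hs hst)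
  have hφ0 : ∀ y, 0 ≤ φ y := cutoff_nonneg
  have hφm : Measurable φ := (contDiff_cutoff (m := 1)).continuous.measurable
  have hint := h.integrable_mul_inner hv hφi
  have hgi : Integrable (fun y => φ y * g y) μ := by
    have : (fun y => φ y * g y) = φ + fun y => φ y * inner ℝ v (ν y) := by
      ext y
      simp [hg, mul_add]
    rw [this]
    exact hφi.add hint
  set μ' := μ.withDensity fun y => ENNReal.ofReal (g y) with hμ'
  have hsub : ∀ τ, 0 < τ → ENNReal.ofReal (3 / 2) * μ {y | τ < φ y} ≤ μ' {y | τ < φ y} := by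
    intro τ hτ
    obtain ⟨ρ, hρt, hρ⟩ := exists_setOf_lt_cutoff_eq_ball x hs hst hτ.le
    rw [hφ, hρ]
    rcases le_or_gt ρ 0 with h0 | h0
    · simp [ball_eq_empty.2 h0]
    have hfin : μ (ball x ρ) ≠ ⊤ := measure_ball_lt_top.ne
    have hi : IntegrableOn (fun y => inner ℝ v (ν y)) (ball x ρ) μ := by
      refine IntegrableOn.of_bound measure_ball_lt_top
        (h.measurable_inner v).aestronglyMeasurable 1 (ae_restrict_of_ae ?_)
      exact h.abs_inner_le hv
    have hi1 : IntegrableOn (fun _ => (1 : ℝ)) (ball x ρ) μ := integrableOn_const hfin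
    have hgb : IntegrableOn g (ball x ρ) μ := hi1.add hi
    rw [hμ', withDensity_apply _ measurableSet_ball, ← ofReal_integral_eq_lintegral_ofReal
      hgb (ae_restrict_of_ae hg0)]
    simp only [hg]
    rw [integral_add hi1 hi, setIntegral_const, smul_eq_mul, mul_one, ← ENNReal.ofReal_toReal hfin,
      ← ENNReal.ofReal_mul (by norm_num)]
    refine ENNReal.ofReal_le_ofReal ?_
    have := hball ρ h0 (hρt.trans ht)
    simp only [Measure.real] at this ⊢
    linarith
  have h1 : ENNReal.ofReal (3 / 2) * ∫⁻ y, ENNReal.ofReal (φ y) ∂μ ≤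
      ∫⁻ y, ENNReal.ofReal (φ y) ∂μ' := by
    rw [lintegral_eq_lintegral_meas_lt μ (Eventually.of_forall hφ0) hφm.aemeasurable,
      lintegral_eq_lintegral_meas_lt μ' (Eventually.of_forall hφ0) hφm.aemeasurable,
      ← lintegral_const_mul' _ _ ENNReal.ofReal_ne_top]
    exact setLIntegral_mono' measurableSet_Ioi hsub
  rw [hμ', lintegral_withDensity_eq_lintegral_mul _ hgm.ennreal_ofReal hφm.ennreal_ofReal,
    ← ofReal_integral_eq_lintegral_ofReal hφi (Eventually.of_forall hφ0),
    ← ENNReal.ofReal_mul (by norm_num)] at h1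
  have h2 : ∫⁻ y, ((fun y => ENNReal.ofReal (g y)) * fun y => ENNReal.ofReal (φ y)) y ∂μ =
      ENNReal.ofReal (∫ y, φ y * g y ∂μ) := by
    rw [ofReal_integral_eq_lintegral_ofReal hgi]
    · refine lintegral_congr fun y => ?_
      rw [Pi.mul_apply, ENNReal.ofReal_mul (hφ0 y), mul_comm]
    · filter_upwards [hg0] with y hy using mul_nonneg (hφ0 y) hy
  rw [h2, ENNReal.ofReal_le_ofReal_iff] at h1
  · have h3 : ∫ y, φ y * g y ∂μ = ∫ y, φ y ∂μ + ∫ y, φ y * inner ℝ v (ν y) ∂μ := by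
      simp only [hg, mul_add, mul_one]
      exact integral_add hφi hint
    rw [h3] at h1
    linarith
  · refine integral_nonneg_of_ae ?_
    filter_upwards [hg0] with y hy using mul_nonneg (hφ0 y) hy

/-- Testing Gauss-Green with the field φv turns the flux in the direction v into ∫_E ∂_vφ, so the
perimeter near x is controlled by the gradient of the cutoff inside E alone. -/
theorem IsGaussGreen.integral_cutoff_le (h : IsGaussGreen E μ ν) {x v : Rn n} (hv : ‖v‖ = 1)
    {t₀ : ℝ} (hball : ∀ ρ, 0 < ρ → ρ ≤ t₀ →
      μ.real (ball x ρ) ≤ 2 * ∫ y in ball x ρ, inner ℝ v (ν y) ∂μ)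
    {s t : ℝ} (hs : 0 ≤ s) (hst : s < t) (ht : t ≤ t₀) :
    ∫ y, cutoff x s t y ∂μ ≤ 2 * ∫ y in E, ‖fderiv ℝ (cutoff x s t) y‖ := by
  have hc : ContDiff ℝ 1 (cutoff x s t) := contDiff_cutoff (m := 1)
  have hs' := hasCompactSupport_cutoff (a := x) hs hst
  refine (h.integral_cutoff_le_two_mul hv hball hs hst ht).trans ?_
  rw [h.integral_mul_inner hc hs']
  have hD : Continuous (fderiv ℝ (cutoff x s t)) := hc.continuous_fderiv one_ne_zero
  have hDc := hs'.fderiv (𝕜 := ℝ)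
  refine mul_le_mul_of_nonneg_left (setIntegral_mono ?_ ?_ ?_) zero_le_two
  · exact ((hD.clm_apply continuous_const).integrable_of_hasCompactSupport
      (hs'.fderiv_apply (𝕜 := ℝ) v)).integrableOn
  · exact (hD.norm.integrable_of_hasCompactSupport hDc.norm).integrableOn
  · intro y
    calc _ ≤ ‖fderiv ℝ (cutoff x s t) y v‖ := Real.le_norm_self _
      _ ≤ _ := by simpa [hv] using (fderiv ℝ (cutoff x s t) y).le_opNorm v

end GaussGreen

/-- Near a point of the reduced boundary the Gauss-Green measure is nearly unidirectional. -/
theorem exists_of_mem_reducedBoundary {n : ℕ} {E : Set (Rn n)} {x : Rn n}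
    (hx : x ∈ reducedBoundary E) :
    ∃ (μ : Measure (Rn n)) (ν : Rn n → Rn n) (v : Rn n) (t₀ : ℝ), IsGaussGreen E μ ν ∧
      (∀ ρ : ℝ, 0 < ρ → 0 < μ (ball x ρ)) ∧ ‖v‖ = 1 ∧ 0 < t₀ ∧
      ∀ ρ, 0 < ρ → ρ ≤ t₀ → μ.real (ball x ρ) ≤ 2 * ∫ y in ball x ρ, inner ℝ v (ν y) ∂μ := by
  obtain ⟨μ, ν, h, hpos, v, hv, hlim⟩ := hx
  have := h.locallyFinite
  have hev := (Metric.tendsto_nhds.1 hlim) (1 / 2) (by norm_num)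
  rw [eventually_nhdsWithin_iff, Metric.eventually_nhds_iff] at hev
  obtain ⟨ε, hε, hev⟩ := hev
  refine ⟨μ, ν, v, ε / 2, h, hpos, hv, by positivity, fun ρ hρ hρt => ?_⟩
  have h1 := hev (y := ρ) (by rw [Real.dist_eq, sub_zero, abs_of_pos hρ]; linarith) hρ
  have hi : IntegrableOn ν (ball x ρ) μ := by
    refine IntegrableOn.of_bound measure_ball_lt_top
      h.measurable.aestronglyMeasurable 1 (ae_restrict_of_ae ?_)
    filter_upwards [h.norm_eq_one] with y hy using hy.le
  have hm : 0 < μ.real (ball x ρ) := ENNReal.toReal_pos (hpos ρ hρ).ne' measure_ball_lt_top.ne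
  rw [integral_inner hi v]
  rw [setAverage_eq, dist_eq_norm] at h1
  set I := ∫ y in ball x ρ, ν y ∂μ
  -- Once the averaged normal is within 1/2 of v, its component along v is at least 1/2; this is the
  -- source of the factor 2.
  have h2 : inner ℝ v (v - (μ.real (ball x ρ))⁻¹ • I) ≤ 1 / 2 := by
    calc _ ≤ ‖v‖ * ‖v - (μ.real (ball x ρ))⁻¹ • I‖ := real_inner_le_norm _ _
      _ ≤ 1 / 2 := by rw [hv, one_mul, norm_sub_rev]; exact h1.le
  rw [inner_sub_right, real_inner_self_eq_norm_sq, hv, inner_smul_right] at h2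
  have h3 : 1 / 2 ≤ (μ.real (ball x ρ))⁻¹ * inner ℝ v I := by linarith
  rw [inv_mul_eq_div, le_div_iff₀ hm] at h3
  linarith

/-- The divergence of a compactly supported field has integral zero, so passing to the complement
only changes the sign of the normal. -/
theorem reducedBoundary_subset_compl {n : ℕ} {E : Set (Rn n)} (hE : MeasurableSet E) :
    reducedBoundary E ⊆ reducedBoundary Eᶜ := by
  rintro x ⟨μ, ν, h, hpos, v, hv, hlim⟩
  refine ⟨μ, fun y => -ν y, ⟨h.locallyFinite, h.measurable.neg, ?_, ?_⟩, hpos, -v, by simpa, ?_⟩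
  · simpa using h.norm_eq_one
  · intro X hX hc
    have h1 := integral_add_compl hE (integrable_divergence hX hc)
    rw [integral_divergence_eq_zero hX hc, h.gauss_green X hX hc] at h1
    simp only [inner_neg_right, integral_neg]
    linarith
  · simpa only [average_neg] using hlim.neg

/-! ### A Sobolev inequality for truncated sets of finite perimeter. -/

open scoped Convolution in
-- The product rule for BV: the distributional gradient of 1_E φ is 1_E ∇φ minus φν dμ, up to the
-- sign convention of the outer normal. Gauss-Green applied to φψ(y-·)w expresses the gradient of
-- the mollification through these two terms, and Tonelli with ∫ψ = 1 removes the mollifier.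
theorem IsGaussGreen.lintegral_fderiv_convolution_le {n : ℕ} {E : Set (Rn n)}
    {μ : Measure (Rn n)} {ν : Rn n → Rn n} (hE : MeasurableSet E) (h : IsGaussGreen E μ ν)
    {φ ψ : Rn n → ℝ} (hφ : ContDiff ℝ 1 φ) (hφc : HasCompactSupport φ) (hφ0 : ∀ y, 0 ≤ φ y)
    (hψ : ContDiff ℝ 1 ψ) (hψc : HasCompactSupport ψ) (hψ0 : ∀ y, 0 ≤ ψ y) (hψ1 : ∫ y, ψ y = 1) :
    ∫⁻ y, ‖fderiv ℝ (E.indicator φ ⋆[ContinuousLinearMap.mul ℝ ℝ, volume] ψ) y‖ₑ ≤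
      ∫⁻ y, ENNReal.ofReal (φ y) ∂μ + ∫⁻ y in E, ENNReal.ofReal ‖fderiv ℝ φ y‖ := by
  have := h.locallyFinite
  set L := ContinuousLinearMap.mul ℝ ℝ with hL
  have hDφ : Continuous (fderiv ℝ φ) := hφ.continuous_fderiv one_ne_zero
  have hDψ : Continuous (fderiv ℝ ψ) := hψ.continuous_fderiv one_ne_zero
  have hφcont := hφ.continuous
  have hψcont := hψ.continuous
  have hf : LocallyIntegrable (E.indicator φ) :=
    ((hφcont.integrable_of_hasCompactSupport hφc).indicator hE).locallyIntegrable
  have hder : ∀ y w, fderiv ℝ (E.indicator φ ⋆[L, volume] ψ) y w =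
      ∫ z in E, φ z * fderiv ℝ ψ (y - z) w := by
    intro y w
    rw [(hψc.hasFDerivAt_convolution_right L hf hψ y).fderiv,
      convolution_precompR_apply L hf (hψc.fderiv (𝕜 := ℝ)) hDψ, convolution_def,
      ← integral_indicator hE]
    refine integral_congr_ae (Eventually.of_forall fun z => ?_)
    by_cases hz : z ∈ E <;> simp [hz, hL]
  have hGG : ∀ y w, ∫ z, φ z * ψ (y - z) * inner ℝ w (ν z) ∂μ =
      ∫ z in E, (ψ (y - z) * fderiv ℝ φ z w - φ z * fderiv ℝ ψ (y - z) w) := by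
    intro y w
    rw [h.integral_mul_inner (φ := fun z => φ z * ψ (y - z)) (by fun_prop) hφc.mul_right]
    refine integral_congr_ae (Eventually.of_forall fun z => ?_)
    have h1 : HasFDerivAt (fun z => ψ (y - z)) (-(fderiv ℝ ψ (y - z))) z := by
      have := ((hψ.differentiable one_ne_zero (y - z)).hasFDerivAt).comp z
        ((hasFDerivAt_id z).const_sub y)
      refine this.congr_fderiv ?_
      ext; simp
    simp only
    rw [(((hφ.differentiable one_ne_zero z).hasFDerivAt).fun_mul h1).fderiv]
    simp
    ring
  set W : Rn n → ℝ := fun y => ∫ z, φ z * ψ (y - z) ∂μ + ∫ z in E, ψ (y - z) * ‖fderiv ℝ φ z‖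
    with hW
  have hi1 : ∀ y, Integrable (fun z => φ z * ψ (y - z)) μ := fun y =>
    (by fun_prop : Continuous fun z => φ z * ψ (y - z)).integrable_of_hasCompactSupport
      hφc.mul_right
  have hi2 : ∀ y, Integrable (fun z => ψ (y - z) * ‖fderiv ℝ φ z‖) := fun y =>
    (by fun_prop : Continuous fun z => ψ (y - z) * ‖fderiv ℝ φ z‖).integrable_of_hasCompactSupport
      ((hφc.fderiv (𝕜 := ℝ)).norm.mul_left)
  have hi3 : ∀ y w, Integrable (fun z => ψ (y - z) * fderiv ℝ φ z w) := fun y w =>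
    (by fun_prop : Continuous fun z => ψ (y - z) * fderiv ℝ φ z w).integrable_of_hasCompactSupport
      ((hφc.fderiv_apply (𝕜 := ℝ) w).mul_left)
  have hi4 : ∀ y w, Integrable (fun z => φ z * fderiv ℝ ψ (y - z) w) := fun y w =>
    (by fun_prop : Continuous fun z => φ z * fderiv ℝ ψ (y - z) w).integrable_of_hasCompactSupport
      hφc.mul_right
  have hbound : ∀ y, ‖fderiv ℝ (E.indicator φ ⋆[L, volume] ψ) y‖ₑ ≤ ENNReal.ofReal (W y) := by
    intro y
    have hW0 : 0 ≤ W y := add_nonneg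
      (integral_nonneg fun z => mul_nonneg (hφ0 z) (hψ0 _))
      (integral_nonneg fun z => mul_nonneg (hψ0 _) (norm_nonneg _))
    rw [← ofReal_norm]
    refine ENNReal.ofReal_le_ofReal (ContinuousLinearMap.opNorm_le_bound _ hW0 fun w => ?_)
    have e := hGG y w
    rw [integral_sub (hi3 y w).integrableOn (hi4 y w).integrableOn, ← hder] at e
    have e' : fderiv ℝ (E.indicator φ ⋆[L, volume] ψ) y w =
      (∫ z in E, ψ (y - z) * fderiv ℝ φ z w) - ∫ z, φ z * ψ (y - z) * inner ℝ w (ν z) ∂μ := by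
      linarith
    rw [e', add_mul, add_comm]
    refine (norm_sub_le _ _).trans (add_le_add ?_ ?_)
    · rw [← integral_mul_const]
      refine norm_integral_le_of_norm_le ((hi2 y).integrableOn.mul_const _)
        (Eventually.of_forall fun z => ?_)
      rw [norm_mul, Real.norm_of_nonneg (hψ0 _), mul_assoc]
      exact mul_le_mul_of_nonneg_left (ContinuousLinearMap.le_opNorm _ _) (hψ0 _)
    · rw [← integral_mul_const]
      refine norm_integral_le_of_norm_le ((hi1 y).mul_const _) ?_
      filter_upwards [h.norm_eq_one] with z hz
      rw [norm_mul, Real.norm_of_nonneg (mul_nonneg (hφ0 _) (hψ0 _))]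
      refine mul_le_mul_of_nonneg_left ?_ (mul_nonneg (hφ0 _) (hψ0 _))
      simpa [hz] using norm_inner_le_norm (𝕜 := ℝ) w (ν z)
  have hψint : ∀ z, ∫⁻ y, ENNReal.ofReal (ψ (y - z)) = 1 := fun z => by
    rw [lintegral_sub_right_eq_self (fun y => ENNReal.ofReal (ψ y)),
      ← ofReal_integral_eq_lintegral_ofReal (hψcont.integrable_of_hasCompactSupport hψc)
        (Eventually.of_forall hψ0), hψ1, ENNReal.ofReal_one]
  calc _ ≤ ∫⁻ y, ENNReal.ofReal (W y) := lintegral_mono hbound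
    _ = ∫⁻ y, (∫⁻ z, ENNReal.ofReal (φ z) * ENNReal.ofReal (ψ (y - z)) ∂μ +
          ∫⁻ z in E, ENNReal.ofReal (‖fderiv ℝ φ z‖) * ENNReal.ofReal (ψ (y - z))) := by
        refine lintegral_congr fun y => ?_
        rw [hW, ENNReal.ofReal_add (integral_nonneg fun z => mul_nonneg (hφ0 z) (hψ0 _))
          (integral_nonneg fun z => mul_nonneg (hψ0 _) (norm_nonneg _)),
          ofReal_integral_eq_lintegral_ofReal (hi1 y)
            (Eventually.of_forall fun z => mul_nonneg (hφ0 z) (hψ0 _)),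
          ofReal_integral_eq_lintegral_ofReal (hi2 y).integrableOn
            (Eventually.of_forall fun z => mul_nonneg (hψ0 _) (norm_nonneg _))]
        congr 1
        · exact lintegral_congr fun z => ENNReal.ofReal_mul (hφ0 z)
        · exact lintegral_congr fun z => by rw [mul_comm, ENNReal.ofReal_mul (norm_nonneg _)]
    _ = _ := by
        have hm1 : Measurable (Function.uncurry fun (y z : Rn n) =>
            ENNReal.ofReal (φ z) * ENNReal.ofReal (ψ (y - z))) := by
          refine Continuous.measurable ?_
          have : Continuous fun p : Rn n × Rn n => ENNReal.ofReal (φ p.2 * ψ (p.1 - p.2)) :=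
            ENNReal.continuous_ofReal.comp (by fun_prop)
          refine this.congr fun p => ?_
          rw [ENNReal.ofReal_mul (hφ0 _)]
          rfl
        have hm2 : Measurable (Function.uncurry fun (y z : Rn n) =>
            ENNReal.ofReal ‖fderiv ℝ φ z‖ * ENNReal.ofReal (ψ (y - z))) := by
          refine Continuous.measurable ?_
          have : Continuous fun p : Rn n × Rn n =>
              ENNReal.ofReal (‖fderiv ℝ φ p.2‖ * ψ (p.1 - p.2)) :=
            ENNReal.continuous_ofReal.comp (by fun_prop)
          refine this.congr fun p => ?_
          rw [ENNReal.ofReal_mul (norm_nonneg _)]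
          rfl
        have hm3 : Measurable fun y => ∫⁻ z, ENNReal.ofReal (φ z) * ENNReal.ofReal (ψ (y - z)) ∂μ :=
          hm1.lintegral_prod_right'
        rw [lintegral_add_left hm3,
          lintegral_lintegral_swap hm1.aemeasurable, lintegral_lintegral_swap hm2.aemeasurable]
        congr 1
        · refine lintegral_congr fun z => ?_
          rw [lintegral_const_mul' _ _ ENNReal.ofReal_ne_top, hψint, mul_one]
        · refine lintegral_congr fun z => ?_
          rw [lintegral_const_mul' _ _ ENNReal.ofReal_ne_top, hψint, mul_one]

open scoped Convolution NNReal in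
-- The Gagliardo-Nirenberg-Sobolev inequality with exponent 1 is applied to mollifications of 1_E φ,
-- whose gradients are bounded in L¹ uniformly by the preceding lemma; a.e. convergence and Fatou
-- give the limit.
theorem exists_sobolev_gaussGreen {n : ℕ} (hn : 2 ≤ n) :
    ∃ C : ℝ≥0, ∀ (E : Set (Rn n)) (μ : Measure (Rn n)) (ν : Rn n → Rn n), MeasurableSet E →
      IsGaussGreen E μ ν → ∀ φ : Rn n → ℝ, ContDiff ℝ 1 φ → HasCompactSupport φ →
      (∀ y, 0 ≤ φ y) → eLpNorm (E.indicator φ) (NNReal.conjExponent n : ℝ≥0) volume ≤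
        C * (∫⁻ y, ENNReal.ofReal (φ y) ∂μ + ∫⁻ y in E, ENNReal.ofReal ‖fderiv ℝ φ y‖) := by
  refine ⟨eLpNormLESNormFDerivOneConst (volume : Measure (Rn n)) (NNReal.conjExponent n : ℝ≥0),
    fun E μ ν hE h φ hφ hφc hφ0 => ?_⟩
  have hp : NNReal.HolderConjugate (Module.finrank ℝ (Rn n)) (NNReal.conjExponent n) := by
    rw [finrank_euclideanSpace_fin]
    exact NNReal.HolderConjugate.conjExponent (by exact_mod_cast hn)
  have hf : LocallyIntegrable (E.indicator φ) :=
    ((hφ.continuous.integrable_of_hasCompactSupport hφc).indicator hE).locallyIntegrable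
  have hfc : HasCompactSupport (E.indicator φ) := hφc.mono fun x hx => by
    rw [Function.mem_support] at hx ⊢
    exact fun h0 => hx (by simp [indicator, h0])
  have hpos : ∀ k : ℕ, (0 : ℝ) < 1 / (k + 1) := fun k => by positivity
  -- The ratio 2 of outer to inner radius is independent of k, as a.e. convergence of the
  -- mollifications requires.
  let b : ℕ → ContDiffBump (0 : Rn n) := fun k =>
    ⟨1 / (k + 1), 2 * (1 / (k + 1)), hpos k, by linarith [hpos k]⟩
  set g : ℕ → Rn n → ℝ := fun k =>
    E.indicator φ ⋆[ContinuousLinearMap.mul ℝ ℝ, volume] (b k).normed volume with hg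
  have hgc : ∀ k, ContDiff ℝ 1 (g k) := fun k =>
    (b k).hasCompactSupport_normed.contDiff_convolution_right (n := 1) _ hf (b k).contDiff_normed
  have hgs : ∀ k, HasCompactSupport (g k) := fun k =>
    hfc.convolution _ (b k).hasCompactSupport_normed
  have hlim : ∀ᵐ x, Tendsto (fun k => g k x) atTop (𝓝 (E.indicator φ x)) := by
    have h1 : Tendsto (fun k => (b k).rOut) atTop (𝓝 0) := by
      have := (tendsto_one_div_add_atTop_nhds_zero_nat (𝕜 := ℝ)).const_mul 2
      rwa [mul_zero] at this
    filter_upwards [ContDiffBump.ae_convolution_tendsto_right_of_locallyIntegrable (K := 2) h1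
      (Eventually.of_forall fun k => le_rfl) hf] with x hx
    refine hx.congr fun k => ?_
    rw [convolution_eq_swap, hg]
    simp only [convolution_def]
    refine integral_congr_ae (Eventually.of_forall fun z => ?_)
    simp [mul_comm]
  refine (Lp.eLpNorm_lim_le_liminf_eLpNorm
    (fun k => (hgc k).continuous.aestronglyMeasurable) _ hlim).trans ?_
  refine liminf_le_of_le (by isBoundedDefault) fun c hc => ?_
  obtain ⟨k, hk⟩ := hc.exists
  refine hk.trans ((eLpNorm_le_eLpNorm_fderiv_one volume (hgc k) (hgs k) hp).trans ?_)
  gcongr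
  rw [eLpNorm_one_eq_lintegral_enorm]
  exact h.lintegral_fderiv_convolution_le hE hφ hφc hφ0 (b k).contDiff_normed
    (b k).hasCompactSupport_normed (b k).nonneg_normed (b k).integral_normed

/-! ### Lower volume density at points of the reduced boundary. -/

/-- A discrete form of "g' ≥ l-1 implies linear growth". Along S_{k+1} = S_k + g(S_k), started at
t₀/2, the increment of g is at least (l-1) times that of S. At the last S_k ≤ t₀ one has t₀/2 < (S_k
- t₀/2) + g(S_k) ≤ (l/(l-1)) g(S_k). -/
theorem linear_lower_bound_of_step_growth {g : ℝ → ℝ} (hg : Monotone g) {l t₀ : ℝ} (hl : 1 < l)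
    (ht₀ : 0 < t₀) (hpos : ∀ s, 0 < s → 0 < g s)
    (hstep : ∀ s, 0 < s → s + g s ≤ t₀ → l * g s ≤ g (s + g s)) :
    (l - 1) / (2 * l) * t₀ ≤ g t₀ := by
  set S : ℕ → ℝ := fun k => (fun s => s + g s)^[k] (t₀ / 2) with hS
  have hS0 : S 0 = t₀ / 2 := rfl
  have hsucc : ∀ k, S (k + 1) = S k + g (S k) := fun k => Function.iterate_succ_apply' _ _ _
  have hSpos : ∀ k, t₀ / 2 ≤ S k := fun k => by
    induction k with
    | zero => exact hS0.ge
    | succ k ih => rw [hsucc]; linarith [hpos (S k) (by linarith)]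
  have hgrow : ∀ k : ℕ, t₀ / 2 + k * g (t₀ / 2) ≤ S k := fun k => by
    induction k with
    | zero => simp [hS0]
    | succ k ih =>
      rw [hsucc]
      push_cast
      linarith [hg (hSpos k)]
  have hex : ∃ k, t₀ < S k := by
    obtain ⟨k, hk⟩ := exists_nat_gt (t₀ / g (t₀ / 2))
    refine ⟨k, ?_⟩
    have h1 := hpos (t₀ / 2) (by linarith)
    rw [div_lt_iff₀ h1] at hk
    linarith [hgrow k]
  have hinv : ∀ k, S k ≤ t₀ → (l - 1) * (S k - t₀ / 2) ≤ g (S k) := fun k => by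
    induction k with
    | zero => intro _; rw [hS0, sub_self, mul_zero]; exact (hpos _ (by linarith)).le
    | succ k ih =>
      intro h
      have hk := hpos (S k) (by linarith [hSpos k])
      rw [hsucc] at h ⊢
      have h1 := ih (by linarith)
      have h2 := hstep (S k) (by linarith [hSpos k]) h
      nlinarith
  classical
  obtain ⟨k, hk⟩ : ∃ k, Nat.find hex = k + 1 := by
    refine Nat.exists_eq_succ_of_ne_zero fun h0 => ?_
    have := Nat.find_spec hex
    rw [h0, hS0] at this
    linarith
  have h1 : S k ≤ t₀ := not_lt.1 (Nat.find_min hex (m := k) (by omega))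
  have h2 : t₀ < S k + g (S k) := by
    rw [← hsucc, ← hk]
    exact Nat.find_spec hex
  have h3 := hinv k h1
  have h4 := hg h1
  rw [div_mul_eq_mul_div, div_le_iff₀ (by linarith)]
  nlinarith

/-- De Giorgi's argument. With m(s) = |E ∩ B_s(x)|, the Sobolev inequality for a cutoff between
radii s and t, whose two terms are both bounded by its gradient on E, gives m(s)^{(n-1)/n}(t-s) ≤
A(m(t)-m(s)). This is a discrete differential inequality for m^{1/n}. The constant κ depends on n
only, the scale t₀ on the point. -/
theorem exists_lower_density_reducedBoundary {n : ℕ} (hn : 2 ≤ n) :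
    ∃ κ : ℝ, 0 < κ ∧ ∀ E : Set (Rn n), MeasurableSet E → ∀ x ∈ reducedBoundary E,
      ∃ t₀ : ℝ, 0 < t₀ ∧ ∀ t, 0 < t → t ≤ t₀ → κ * t ^ n ≤ volume.real (E ∩ ball x t) := by
  obtain ⟨C, hC⟩ := exists_sobolev_gaussGreen hn
  obtain ⟨K, hK0, hK⟩ := exists_deriv_smoothTransition_bound
  -- The factor 6K is 3 · 2K: twice the gradient energy for the μ-term, once for the term on E, and
  -- 2K from the gradient of the cutoff. The summand 1 makes A positive.
  set A : ℝ := 6 * (C + 1) * K with hA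
  have hC0 : (0 : ℝ) ≤ C := C.2
  have hApos : 0 < A := by positivity
  have hn0 : n ≠ 0 := by omega
  have hn0' : (n : ℝ) ≠ 0 := by exact_mod_cast hn0
  have hn1 : (1 : ℝ) ≤ n := by exact_mod_cast (by omega : 1 ≤ n)
  set l : ℝ := (1 + A⁻¹) ^ (n : ℝ)⁻¹ with hl
  have hl1 : 1 < l := Real.one_lt_rpow (by linarith [inv_pos.2 hApos]) (by positivity)
  refine ⟨((l - 1) / (2 * l)) ^ n, pow_pos (div_pos (by linarith) (by linarith)) n,
    fun E hE x hx => ?_⟩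
  obtain ⟨μ, ν, v, t₀, h, hμpos, hv, ht₀, hball⟩ := exists_of_mem_reducedBoundary hx
  have := h.locallyFinite
  set m : ℝ → ℝ := fun s => volume.real (E ∩ ball x s) with hm
  have hfin : ∀ s, volume (E ∩ ball x s) ≠ ⊤ := fun s =>
    ((measure_mono inter_subset_right).trans_lt measure_ball_lt_top).ne
  have hmmono : Monotone m := fun s t hst =>
    measureReal_mono (inter_subset_inter_right _ (ball_subset_ball hst)) (hfin t)
  -- the energy of a cutoff on `E` is controlled by the volume of `E` in the annulus
  have henergy : ∀ s t, 0 < s → s < t →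
      ∫ y in E, ‖fderiv ℝ (cutoff x s t) y‖ ≤ 2 * K / (t - s) * (m t - m s) := by
    intro s t hs hst
    have hdiff : m t - m s = volume.real ((E ∩ ball x t) \ (E ∩ ball x s)) := by
      rw [measureReal_sdiff (inter_subset_inter_right _ (ball_subset_ball hst.le))
        (hE.inter measurableSet_ball) (hfin t)]
    have hmeas : MeasurableSet ((E ∩ ball x t) \ (E ∩ ball x s)) :=
      MeasurableSet.diff (hE.inter measurableSet_ball) (hE.inter measurableSet_ball)
    rw [hdiff, setIntegral_eq_of_subset_of_forall_sdiff_eq_zero hE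
      (sdiff_subset.trans inter_subset_left) (s := (E ∩ ball x t) \ (E ∩ ball x s))]
    · refine (Real.le_norm_self _).trans ?_
      refine norm_setIntegral_le_of_norm_le_const (lt_top_iff_ne_top.2 ?_) fun y _ => ?_
      · exact ((measure_mono sdiff_subset).trans_lt (lt_top_iff_ne_top.2 (hfin t))).ne
      · rw [norm_norm]
        exact norm_fderiv_cutoff_le hK hs.le hst y
    · intro y hy
      rw [fderiv_cutoff_eq_zero hs.le hst, norm_zero]
      by_contra! hcon
      refine hy.2 ⟨⟨hy.1, by rw [mem_ball, dist_eq_norm]; exact hcon.2⟩, fun h2 => ?_⟩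
      have := h2.2
      rw [mem_ball, dist_eq_norm] at this
      linarith [hcon.1]
  have hmpos : ∀ s, 0 < s → 0 < m s := by
    have aux : ∀ s, 0 < s → s ≤ t₀ → 0 < m s := by
      intro s hs hst
      by_contra! hle
      have h0 : m s = 0 := le_antisymm hle measureReal_nonneg
      have h1 := h.integral_cutoff_le hv hball (half_pos hs).le (half_lt_self hs) hst
      have h2 := henergy (s / 2) s (half_pos hs) (half_lt_self hs)
      have h3 : m (s / 2) = 0 :=
        le_antisymm ((hmmono (half_lt_self hs).le).trans h0.le) measureReal_nonneg
      rw [h0, h3, sub_zero, mul_zero] at h2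
      have h4 : μ.real (ball x (s / 2)) ≤ ∫ y, cutoff x (s / 2) s y ∂μ := by
        rw [← integral_indicator_one measurableSet_ball]
        have hci : Integrable (cutoff x (s / 2) s) μ := h.integrable_of_hasCompactSupport
          (contDiff_cutoff (m := 1)).continuous
          (hasCompactSupport_cutoff (half_pos hs).le (half_lt_self hs))
        refine integral_mono ((integrable_indicator_iff measurableSet_ball).2
          (integrableOn_const measure_ball_lt_top.ne)) hci fun y => ?_
        by_cases hy : y ∈ ball x (s / 2)
        · rw [indicator_of_mem hy, cutoff_eq_one (half_pos hs).le (half_lt_self hs)]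
          · rfl
          · rw [mem_ball, dist_eq_norm] at hy
            exact hy.le
        · rw [indicator_of_notMem hy]
          exact cutoff_nonneg y
      have h5 : 0 < μ.real (ball x (s / 2)) :=
        ENNReal.toReal_pos (hμpos _ (half_pos hs)).ne' measure_ball_lt_top.ne
      linarith
    intro s hs
    exact (aux (min s t₀) (lt_min hs ht₀) (min_le_right _ _)).trans_le (hmmono (min_le_left _ _))
  set g : ℝ → ℝ := fun s => m s ^ (n : ℝ)⁻¹ with hg
  have hgn : ∀ s, g s ^ n = m s := fun s => Real.rpow_inv_natCast_pow measureReal_nonneg hn0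
  have hgpos : ∀ s, 0 < s → 0 < g s := fun s hs => Real.rpow_pos_of_pos (hmpos s hs) _
  have hgmono : Monotone g := fun s t hst =>
    Real.rpow_le_rpow measureReal_nonneg (hmmono hst) (by positivity)
  have hiso : ∀ s t, 0 < s → s < t → t ≤ t₀ → g s ^ (n - 1) * (t - s) ≤ A * (m t - m s) := by
    intro s t hs hst ht
    set φ := cutoff x s t with hφ
    have hφ1 : ContDiff ℝ 1 φ := contDiff_cutoff (m := 1)
    have hφc : HasCompactSupport φ := hasCompactSupport_cutoff hs.le hst
    have hsob := hC E μ ν hE h φ hφ1 hφc cutoff_nonneg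
    have hi1 : Integrable φ μ := h.integrable_of_hasCompactSupport hφ1.continuous hφc
    have hi2 : IntegrableOn (fun y => ‖fderiv ℝ φ y‖) E :=
      ((hφ1.continuous_fderiv one_ne_zero).norm.integrable_of_hasCompactSupport
        (hφc.fderiv (𝕜 := ℝ)).norm).integrableOn
    rw [← ofReal_integral_eq_lintegral_ofReal hi1 (Eventually.of_forall cutoff_nonneg),
      ← ofReal_integral_eq_lintegral_ofReal hi2 (Eventually.of_forall fun y => norm_nonneg _),
      ← ENNReal.ofReal_add (integral_nonneg cutoff_nonneg)
        (integral_nonneg fun y => norm_nonneg _), ← ENNReal.ofReal_coe_nnreal (p := C),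
      ← ENNReal.ofReal_mul hC0] at hsob
    have hcoe : ((NNReal.conjExponent n : NNReal) : ℝ) = n / (n - 1) := by
      rw [NNReal.conjExponent, NNReal.coe_div, NNReal.coe_sub (by exact_mod_cast hn1)]
      simp
    have hlow : ENNReal.ofReal (g s ^ (n - 1)) ≤
        eLpNorm (E.indicator φ) (NNReal.conjExponent n : NNReal) volume := by
      have hp0 : (NNReal.conjExponent n : NNReal) ≠ 0 := by
        intro h0
        have h1 : ((n : ℝ) / (n - 1)) = 0 := by rw [← hcoe, h0]; rfl
        have h2 : (2 : ℝ) ≤ n := by exact_mod_cast hn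
        have : 0 < (n : ℝ) / (n - 1) := div_pos (by linarith) (by linarith)
        linarith
      have h1 : eLpNorm ((E ∩ ball x s).indicator fun _ => (1 : ℝ))
          (NNReal.conjExponent n : NNReal) volume ≤
          eLpNorm (E.indicator φ) (NNReal.conjExponent n : NNReal) volume := by
        refine eLpNorm_mono fun y => ?_
        by_cases hy : y ∈ E ∩ ball x s
        · have h2 := hy.2
          rw [mem_ball, dist_eq_norm] at h2
          rw [indicator_of_mem hy, indicator_of_mem hy.1, hφ, cutoff_eq_one hs.le hst h2.le]
        · rw [indicator_of_notMem hy, norm_zero]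
          exact norm_nonneg _
      rw [eLpNorm_indicator_const (hE.inter measurableSet_ball) (by exact_mod_cast hp0)
        ENNReal.coe_ne_top] at h1
      refine le_trans (le_of_eq ?_) h1
      rw [enorm_one, one_mul, ENNReal.coe_toReal, hcoe, ← ENNReal.ofReal_toReal (hfin s),
        ENNReal.ofReal_rpow_of_nonneg ENNReal.toReal_nonneg
          (by rw [one_div_div]; exact div_nonneg (by linarith) (by linarith)), hg]
      congr 1
      simp only
      rw [← Real.rpow_natCast, ← Real.rpow_mul measureReal_nonneg, Nat.cast_sub (by omega)]
      congr 1
      field_simp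
      simp
    have h1 := (ENNReal.ofReal_le_ofReal_iff (mul_nonneg hC0 (add_nonneg
      (integral_nonneg cutoff_nonneg) (integral_nonneg fun y => norm_nonneg _)))).1
      (hlow.trans hsob)
    have h2 := h.integral_cutoff_le hv hball hs.le hst ht
    have h3 := henergy s t hs hst
    have h4 : g s ^ (n - 1) ≤ C * (3 * (2 * K / (t - s) * (m t - m s))) := by
      refine h1.trans (mul_le_mul_of_nonneg_left ?_ hC0)
      linarith
    have hts : 0 < t - s := by linarith
    have hmm : 0 ≤ m t - m s := by linarith [hmmono hst.le]
    calc g s ^ (n - 1) * (t - s) ≤ C * (3 * (2 * K / (t - s) * (m t - m s))) * (t - s) :=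
          mul_le_mul_of_nonneg_right h4 hts.le
      _ = 6 * C * K * (m t - m s) := by field_simp; ring
      _ ≤ A * (m t - m s) := by
          refine mul_le_mul_of_nonneg_right ?_ hmm
          rw [hA]
          nlinarith
  refine ⟨t₀, ht₀, fun t ht htt => ?_⟩
  -- The step t - s = g(s) makes the left side of `hiso` equal to g(s)^n, hence g(s+g(s))^n ≥
  -- (1+1/A) g(s)^n; this fixes l.
  have hmain := linear_lower_bound_of_step_growth hgmono hl1 ht hgpos (fun s hs hst => by
    have hgs := hgpos s hs
    have h1 := hiso s (s + g s) hs (by linarith) (hst.trans htt)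
    rw [add_sub_cancel_left, ← pow_succ, Nat.sub_add_cancel (by omega), ← hgn, ← hgn] at h1
    have h2 : (1 + A⁻¹) * g s ^ n ≤ g (s + g s) ^ n := by
      have : A⁻¹ * g s ^ n ≤ g (s + g s) ^ n - g s ^ n := by
        rw [inv_mul_le_iff₀ hApos]
        exact h1
      linarith
    have h3 : l ^ n = 1 + A⁻¹ := Real.rpow_inv_natCast_pow (by positivity) hn0
    rw [← h3, ← mul_pow] at h2
    exact le_of_pow_le_pow_left₀ hn0 (hgpos _ (by linarith)).le h2)
  change _ ≤ m t
  rw [← hgn, ← mul_pow]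
  exact pow_le_pow_left₀ (mul_nonneg (div_nonneg (by linarith) (by linarith)) ht.le) hmain n

/-! ### Comparison of Hausdorff measure with a measure of positive density. -/

open scoped MeasureTheory in
-- Vitali: disjoint balls of radius ρ whose 5-fold enlargements cover A. The enlarged balls have
-- diameter at most 10ρ, and their d-th powers are paid for by the disjoint masses inside U.
theorem hausdorffMeasure_le_of_frequently_le {X : Type*} [MetricSpace X]
    [SecondCountableTopology X] [MeasurableSpace X] [BorelSpace X] (m : Measure X) {A U : Set X}
    {d c : ℝ} (hd : 0 ≤ d) (hc : 0 < c)
    (h : ∀ x ∈ A, ∀ δ : ℝ, 0 < δ → ∃ ρ, 0 < ρ ∧ ρ < δ ∧ closedBall x ρ ⊆ U ∧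
      ENNReal.ofReal (c * ρ ^ d) ≤ m (closedBall x ρ)) :
    μH[d] A ≤ ENNReal.ofReal (10 ^ d / c) * m U := by
  have hpos : ∀ k : ℕ, (0 : ℝ) < 1 / (k + 1) := fun k => by positivity
  choose! ρ hρ0 hρk hρU hρm using fun (k : ℕ) (x : A) => h x x.2 (1 / (k + 1)) (hpos k)
  choose u _ hdisj hcov using fun k : ℕ =>
    Vitali.exists_disjoint_subfamily_covering_enlargement_closedBall (univ : Set A)
      (fun x => (x : X)) (ρ k) (1 / (k + 1)) (fun x _ => (hρk k x).le) 5 (by norm_num)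
  have hcount : ∀ k, (u k).Countable := fun k =>
    (hdisj k).countable_of_nonempty_interior fun x _ =>
      ⟨x, ball_subset_interior_closedBall (mem_ball_self (hρ0 k x))⟩
  have := fun k => (hcount k).to_subtype
  have hr : Tendsto (fun k : ℕ => ENNReal.ofReal (10 * (1 / ((k : ℝ) + 1)))) atTop (𝓝 0) := by
    have h1 := (tendsto_one_div_add_atTop_nhds_zero_nat (𝕜 := ℝ)).const_mul 10
    rw [mul_zero] at h1
    simpa using ENNReal.tendsto_ofReal h1
  have hdiam : ∀ k (x : A), ediam (closedBall (x : X) (5 * ρ k x)) ≤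
      ENNReal.ofReal (10 * ρ k x) := fun k x => by
    refine ediam_le fun y hy z hz => ?_
    rw [edist_dist]
    refine ENNReal.ofReal_le_ofReal ((dist_triangle_right y z (x : X)).trans ?_)
    rw [mem_closedBall] at hy hz
    linarith
  refine (Measure.hausdorffMeasure_le_liminf_tsum d A _ hr
    (fun k (i : u k) => closedBall ((i : A) : X) (5 * ρ k i))
    (Eventually.of_forall fun k i => ?_) (Eventually.of_forall fun k x hx => ?_)).trans ?_
  · refine (hdiam k i).trans (ENNReal.ofReal_le_ofReal ?_)
    have := hρk k i
    linarith
  · obtain ⟨b, hb, hsub⟩ := hcov k ⟨x, hx⟩ (mem_univ _)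
    exact mem_iUnion.2 ⟨⟨b, hb⟩, hsub (mem_closedBall_self (hρ0 k _).le)⟩
  · refine liminf_le_of_le (by isBoundedDefault) fun b hb => ?_
    obtain ⟨k, hk⟩ := hb.exists
    refine hk.trans ?_
    calc ∑' i : u k, ediam (closedBall ((i : A) : X) (5 * ρ k i)) ^ d
        ≤ ∑' i : u k, ENNReal.ofReal (10 ^ d / c) * m (closedBall ((i : A) : X) (ρ k i)) := by
          refine ENNReal.tsum_le_tsum fun i => ?_
          have hi := hρ0 k i
          calc _ ≤ ENNReal.ofReal (10 * ρ k i) ^ d := ENNReal.rpow_le_rpow (hdiam k i) hd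
            _ = ENNReal.ofReal (10 ^ d / c) * ENNReal.ofReal (c * ρ k i ^ d) := by
                rw [ENNReal.ofReal_rpow_of_nonneg (by positivity) hd,
                  ← ENNReal.ofReal_mul (by positivity), Real.mul_rpow (by norm_num) hi.le]
                congr 1
                field_simp
            _ ≤ _ := by gcongr; exact hρm k i
      _ = ENNReal.ofReal (10 ^ d / c) * m (⋃ i : u k, closedBall ((i : A) : X) (ρ k i)) := by
          rw [ENNReal.tsum_mul_left, measure_iUnion]
          · exact (pairwise_subtype_iff_pairwise_set _ _).2 (hdisj k)
          · exact fun i => measurableSet_closedBall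
      _ ≤ _ := by
          gcongr
          exact iUnion_subset fun i => hρU k i

/-! ### Surface measure of spheres. -/

/-- The pushforward of Lebesgue measure on the unit ball to the sphere `∂B_r(q)` under the radial
projection, multiplied by `r ^ (n - 1)`. -/
noncomputable def sphereMeasure {n : ℕ} (q : Rn n) (r : ℝ) : Measure (Rn n) :=
  ENNReal.ofReal (r ^ (n - 1)) •
    (volume.restrict (ball (0 : Rn n) 1)).map fun z => q + r • (‖z‖⁻¹ • z)

section SphereMeasure

variable {n : ℕ}

theorem measurable_radial (q : Rn n) (r : ℝ) :
    Measurable fun z : Rn n => q + r • (‖z‖⁻¹ • z) := by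
  fun_prop

theorem sphereMeasure_univ (q : Rn n) (r : ℝ) :
    sphereMeasure q r univ = ENNReal.ofReal (r ^ (n - 1)) * volume (ball (0 : Rn n) 1) := by
  simp [sphereMeasure, Measure.map_apply (measurable_radial q r) MeasurableSet.univ]

theorem sphereMeasure_apply (q : Rn n) (r : ℝ) {s : Set (Rn n)} (hs : MeasurableSet s) :
    sphereMeasure q r s = ENNReal.ofReal (r ^ (n - 1)) *
      volume ({z | q + r • (‖z‖⁻¹ • z) ∈ s} ∩ ball 0 1) := by
  rw [sphereMeasure, Measure.smul_apply, Measure.map_apply (measurable_radial q r) hs,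
    Measure.restrict_apply (measurable_radial q r hs), smul_eq_mul]
  rfl

instance (q : Rn n) (r : ℝ) : IsFiniteMeasure (sphereMeasure q r) := by
  refine ⟨?_⟩
  rw [sphereMeasure_univ]
  exact ENNReal.mul_lt_top ENNReal.ofReal_lt_top measure_ball_lt_top

theorem sphereMeasure_compl_sphere (hn : n ≠ 0) (q : Rn n) {r : ℝ} (hr : 0 < r) :
    sphereMeasure q r (sphere q r)ᶜ = 0 := by
  have : Nonempty (Fin n) := Fin.pos_iff_nonempty.1 (Nat.pos_of_ne_zero hn)
  rw [sphereMeasure_apply q r isClosed_sphere.measurableSet.compl]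
  have h0 : {z : Rn n | q + r • (‖z‖⁻¹ • z) ∈ (sphere q r)ᶜ} ∩ ball 0 1 ⊆ {0} := by
    intro z hz
    by_contra hne
    refine hz.1 ?_
    have : ‖z‖ ≠ 0 := norm_ne_zero_iff.2 hne
    rw [mem_sphere, dist_eq_norm, add_sub_cancel_left, norm_smul, norm_smul, norm_inv, norm_norm,
      inv_mul_cancel₀ this, mul_one, Real.norm_of_nonneg hr.le]
  rw [measure_mono_null h0 (measure_singleton _), mul_zero]

theorem norm_normalize_sub_lt {θ z : Rn n} (hθ : ‖θ‖ = 1) {η t : ℝ} (hη : 0 < η) (hη1 : η ≤ 1)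
    (ht : 1 / 2 ≤ t) (hz : ‖z - t • θ‖ < η / 8) : ‖‖z‖⁻¹ • z - θ‖ < η := by
  have ht0 : 0 < t := by linarith
  have htn : ‖t • θ‖ = t := by rw [norm_smul, hθ, mul_one, Real.norm_of_nonneg ht0.le]
  have h1 : |‖z‖ - t| < η / 8 := by
    have := abs_norm_sub_norm_le z (t • θ)
    rw [htn] at this
    linarith
  have hz0 : 0 < ‖z‖ := by linarith [(abs_lt.1 h1).1]
  have h2 : ‖‖z‖⁻¹ • z - t⁻¹ • z‖ ≤ η / 4 := by
    rw [← sub_smul, norm_smul, Real.norm_eq_abs]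
    have : (‖z‖⁻¹ - t⁻¹) = (t - ‖z‖) / (‖z‖ * t) := by field_simp
    rw [this, abs_div, abs_of_pos (mul_pos hz0 ht0), abs_sub_comm, div_mul_eq_mul_div,
      div_le_iff₀ (mul_pos hz0 ht0)]
    nlinarith [mul_nonneg (mul_pos hη hz0).le (sub_nonneg.2 ht),
      mul_le_mul_of_nonneg_right h1.le hz0.le]
  have h3 : ‖t⁻¹ • z - θ‖ ≤ η / 4 := by
    have : t⁻¹ • z - θ = t⁻¹ • (z - t • θ) := by
      rw [smul_sub, smul_smul, inv_mul_cancel₀ ht0.ne', one_smul]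
    rw [this, norm_smul, norm_inv, Real.norm_of_nonneg ht0.le, inv_mul_le_iff₀ ht0]
    nlinarith
  calc _ = ‖(‖z‖⁻¹ • z - t⁻¹ • z) + (t⁻¹ • z - θ)‖ := by congr 1; abel
    _ ≤ η / 4 + η / 4 := (norm_add_le _ _).trans (add_le_add h2 h3)
    _ < η := by linarith

/-- A single ball in the cone would give only order η^n. About 1/η disjoint balls of radius η/8 are
strung along the ray, with centres between θ/2 and 3θ/4 spaced by η/4, and yield the order η^{n-1}.
-/
theorem le_volume_cone (hn : n ≠ 0) {θ : Rn n} (hθ : ‖θ‖ = 1) {η : ℝ} (hη : 0 < η) (hη1 : η ≤ 1) :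
    ENNReal.ofReal (η ^ (n - 1) / 8 ^ n) * volume (ball (0 : Rn n) 1) ≤
      volume ({z : Rn n | ‖‖z‖⁻¹ • z - θ‖ < η} ∩ ball 0 1) := by
  set N : ℕ := ⌊1 / η⌋₊ + 1 with hN
  set t : ℕ → ℝ := fun j => 1 / 2 + j * (η / 4) with ht
  have hthalf : ∀ j, 1 / 2 ≤ t j := fun j => by
    have : 0 ≤ (j : ℝ) * (η / 4) := by positivity
    simp only [ht]
    linarith
  have htle : ∀ j < N, t j ≤ 3 / 4 := fun j hj => by
    have h1 : (j : ℝ) ≤ 1 / η := by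
      refine le_trans ?_ (Nat.floor_le (by positivity))
      exact_mod_cast (by omega : j ≤ ⌊1 / η⌋₊)
    rw [le_div_iff₀ hη] at h1
    simp only [ht]
    linarith
  have hsub : (⋃ j ∈ Finset.range N, ball (t j • θ) (η / 8)) ⊆
      {z : Rn n | ‖‖z‖⁻¹ • z - θ‖ < η} ∩ ball 0 1 := by
    intro z hz
    simp only [mem_iUnion, Finset.mem_range] at hz
    obtain ⟨j, hj, hz⟩ := hz
    rw [mem_ball, dist_eq_norm] at hz
    refine ⟨norm_normalize_sub_lt hθ hη hη1 (hthalf j) hz, ?_⟩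
    rw [mem_ball_zero_iff]
    have h1 : ‖t j • θ‖ = t j := by
      rw [norm_smul, hθ, mul_one, Real.norm_of_nonneg (by linarith [hthalf j])]
    have h2 := norm_le_insert' z (t j • θ)
    linarith [htle j hj]
  refine le_trans ?_ (measure_mono hsub)
  rw [measure_biUnion_finset]
  · have hball : ∀ j, volume (ball (t j • θ) (η / 8)) =
        ENNReal.ofReal ((η / 8) ^ n) * volume (ball (0 : Rn n) 1) := fun j => by
      rw [Measure.addHaar_ball_of_pos _ _ (by positivity), finrank_euclideanSpace_fin]
    simp_rw [hball, Finset.sum_const, Finset.card_range, nsmul_eq_mul]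
    rw [← mul_assoc, ← ENNReal.ofReal_natCast, ← ENNReal.ofReal_mul (by positivity)]
    gcongr
    have h1 : 1 / η ≤ N := by
      rw [hN]
      push_cast
      exact (Nat.lt_floor_add_one _).le
    calc η ^ (n - 1) / 8 ^ n = 1 / η * (η / 8) ^ n := by
          obtain ⟨k, rfl⟩ := Nat.exists_eq_succ_of_ne_zero hn
          simp only [Nat.succ_eq_add_one, Nat.add_sub_cancel, div_pow, pow_succ]
          field_simp
      _ ≤ N * (η / 8) ^ n := by gcongr
  · intro i _ j _ hij
    refine ball_disjoint_ball ?_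
    rw [dist_eq_norm, ← sub_smul, norm_smul, hθ, mul_one, Real.norm_eq_abs]
    have h1 : t i - t j = ((i : ℝ) - j) * (η / 4) := by simp only [ht]; ring
    have h2 : (1 : ℝ) ≤ |(i : ℝ) - j| := by
      have : (1 : ℤ) ≤ |(i : ℤ) - j| := Int.one_le_abs (sub_ne_zero.2 (by exact_mod_cast hij))
      exact_mod_cast this
    rw [h1, abs_mul, abs_of_pos (by positivity : 0 < η / 4)]
    nlinarith
  · exact fun j _ => measurableSet_ball

theorem exists_le_sphereMeasure_ball (hn : n ≠ 0) :
    ∃ c : ℝ, 0 < c ∧ ∀ (q y : Rn n) (r ρ : ℝ), 0 < ρ → ρ ≤ r → dist y q = r →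
      ENNReal.ofReal (c * ρ ^ (n - 1)) ≤ sphereMeasure q r (ball y ρ) := by
  have hω : 0 < volume.real (ball (0 : Rn n) 1) :=
    ENNReal.toReal_pos (measure_ball_pos _ _ one_pos).ne' measure_ball_lt_top.ne
  refine ⟨volume.real (ball (0 : Rn n) 1) / 8 ^ n, by positivity, fun q y r ρ hρ hρr hy => ?_⟩
  have hr : 0 < r := hρ.trans_le hρr
  have hθ : ‖r⁻¹ • (y - q)‖ = 1 := by
    rw [norm_smul, ← dist_eq_norm, hy, norm_inv, Real.norm_of_nonneg hr.le, inv_mul_cancel₀ hr.ne']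
  have h1 := le_volume_cone hn hθ (div_pos hρ hr) ((div_le_one hr).2 hρr)
  rw [sphereMeasure_apply q r measurableSet_ball]
  have hset : {z : Rn n | q + r • (‖z‖⁻¹ • z) ∈ ball y ρ} =
      {z : Rn n | ‖‖z‖⁻¹ • z - r⁻¹ • (y - q)‖ < ρ / r} := by
    ext z
    have : q + r • (‖z‖⁻¹ • z) - y = r • (‖z‖⁻¹ • z - r⁻¹ • (y - q)) := by
      rw [smul_sub, smul_smul r r⁻¹, mul_inv_cancel₀ hr.ne', one_smul]
      abel
    simp only [mem_ofPred_eq, mem_ball, dist_eq_norm]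
    rw [this, norm_smul, Real.norm_of_nonneg hr.le, lt_div_iff₀ hr, mul_comm]
  rw [hset]
  refine le_trans (le_of_eq ?_) (mul_le_mul_right h1 _)
  rw [← ENNReal.ofReal_toReal (measure_ball_lt_top (μ := volume) (x := (0 : Rn n)) (r := 1)).ne,
    ← ENNReal.ofReal_mul (by positivity), ← ENNReal.ofReal_mul (by positivity)]
  congr 1
  rw [Measure.real, div_pow]
  field_simp

/-- The (n-1)-dimensional lower density of `sphereMeasure` on its sphere feeds the Vitali
comparison; the total mass supplies r^{n-1}. -/
theorem exists_euclideanHausdorffMeasure_sphere_le (hn : n ≠ 0) :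
    ∃ C : ℝ, 0 < C ∧ ∀ (q : Rn n) (r : ℝ), 0 < r →
      Measure.euclideanHausdorffMeasure (n - 1) (sphere q r) ≤
        ENNReal.ofReal (C * r ^ (n - 1)) := by
  obtain ⟨c, hc, h⟩ := exists_le_sphereMeasure_ball hn
  have hω : 0 < volume.real (ball (0 : Rn n) 1) :=
    ENNReal.toReal_pos (measure_ball_pos _ _ one_pos).ne' measure_ball_lt_top.ne
  set s := Measure.addHaarScalarFactor (volume : Measure (Rn (n - 1))) μH[(n - 1 : ℕ)] with hs
  refine ⟨(s + 1) * (10 ^ (((n - 1 : ℕ) : ℝ)) / c * volume.real (ball (0 : Rn n) 1)),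
    by positivity, fun q r hr => ?_⟩
  have h1 := hausdorffMeasure_le_of_frequently_le (sphereMeasure q r) (A := sphere q r)
    (U := univ) (d := (n - 1 : ℕ)) (Nat.cast_nonneg _) hc (fun x hx δ hδ =>
      ⟨min r (δ / 2), lt_min hr (by linarith), (min_le_right _ _).trans_lt (by linarith),
        subset_univ _, by
          rw [Real.rpow_natCast]
          exact (h q x r _ (lt_min hr (by linarith)) (min_le_left _ _) hx).trans
            (measure_mono ball_subset_closedBall)⟩)
  rw [sphereMeasure_univ, ← ENNReal.ofReal_toReal
    (measure_ball_lt_top (μ := volume) (x := (0 : Rn n)) (r := 1)).ne,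
    ← ENNReal.ofReal_mul (by positivity), ← ENNReal.ofReal_mul (by positivity)] at h1
  rw [Measure.euclideanHausdorffMeasure_def, Measure.smul_apply, ENNReal.smul_def, smul_eq_mul]
  refine (mul_le_mul_right h1 _).trans ?_
  rw [← ENNReal.ofReal_coe_nnreal, ← ENNReal.ofReal_mul (NNReal.coe_nonneg _)]
  refine ENNReal.ofReal_le_ofReal ?_
  change ((s : NNReal) : ℝ) * _ ≤ _
  have : (0 : ℝ) ≤ 10 ^ (((n - 1 : ℕ) : ℝ)) / c * (r ^ (n - 1) * volume.real (ball (0 : Rn n) 1)) := by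
    positivity
  calc _ ≤ ((s : ℝ) + 1) * (10 ^ (((n - 1 : ℕ) : ℝ)) / c *
      (r ^ (n - 1) * volume.real (ball (0 : Rn n) 1))) := by
        simp only [Measure.real] at this ⊢
        linarith
    _ = _ := by ring

end SphereMeasure

/-- Dropping the first coordinate is 1-Lipschitz, and the image of the sphere contains the ball of
the same radius one dimension lower. -/
theorem volume_ball_le_euclideanHausdorffMeasure_sphere (m : ℕ) {R : ℝ} (hR : 0 < R) :
    volume (ball (0 : Rn m) R) ≤
      Measure.euclideanHausdorffMeasure m (sphere (0 : Rn (m + 1)) R) := by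
  set P : Rn (m + 1) → Rn m := fun x => WithLp.toLp 2 fun i => x i.succ with hP
  have hL : LipschitzWith 1 P := by
    refine LipschitzWith.of_dist_le_mul fun x y => ?_
    rw [NNReal.coe_one, one_mul, EuclideanSpace.dist_eq, EuclideanSpace.dist_eq,
      Fin.sum_univ_succ (n := m)]
    refine Real.sqrt_le_sqrt ?_
    simp only [hP]
    linarith [sq_nonneg (dist (x 0) (y 0))]
  have hsub : ball (0 : Rn m) R ⊆ P '' sphere (0 : Rn (m + 1)) R := by
    intro y hy
    rw [mem_ball_zero_iff] at hy
    have h0 : 0 ≤ R ^ 2 - ‖y‖ ^ 2 := by nlinarith [norm_nonneg y]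
    refine ⟨WithLp.toLp 2 (Fin.cons (√(R ^ 2 - ‖y‖ ^ 2)) y), ?_, ?_⟩
    · rw [mem_sphere_zero_iff_norm, EuclideanSpace.norm_eq, Fin.sum_univ_succ]
      simp only [Fin.cons_zero, Fin.cons_succ, Real.norm_eq_abs, sq_abs, Real.sq_sqrt h0]
      rw [← EuclideanSpace.real_norm_sq_eq, sub_add_cancel, Real.sqrt_sq hR.le]
    · ext i
      simp [hP]
  rw [← EuclideanSpace.euclideanHausdorffMeasure_eq_volume]
  refine (measure_mono hsub).trans ?_
  rw [Measure.euclideanHausdorffMeasure_def, Measure.euclideanHausdorffMeasure_def,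
    Measure.smul_apply, Measure.smul_apply, ENNReal.smul_def, ENNReal.smul_def]
  refine mul_le_mul_right ?_ _
  simpa using hL.hausdorffMeasure_image_le (d := m) (Nat.cast_nonneg _) (sphere 0 R)

theorem volume_ball_eq {n : ℕ} (x : Rn n) {r : ℝ} (hr : 0 < r) :
    volume (ball x r) = ENNReal.ofReal (r ^ n) * volume (ball (0 : Rn n) 1) := by
  rw [Measure.addHaar_ball_of_pos _ _ hr, finrank_euclideanSpace_fin]

theorem volume_real_ball_eq {n : ℕ} (x : Rn n) {r : ℝ} (hr : 0 < r) :
    volume.real (ball x r) = r ^ n * volume.real (ball (0 : Rn n) 1) := by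
  rw [Measure.real, volume_ball_eq x hr, ENNReal.toReal_mul, ENNReal.toReal_ofReal (by positivity)]
  rfl

/-! ### Gauss-Green formula and reduced boundary of a ball. -/

section BallGaussGreen

variable {n : ℕ}

/-- The function equal to `1` on `B_{R-ε}`, to `0` off `B_R`, and affine in the norm in between. -/
noncomputable def ramp (R ε : ℝ) (x : Rn n) : ℝ := max 0 (min 1 (ε⁻¹ * (R - ‖x‖)))

theorem exists_lipschitzWith_ramp (R ε : ℝ) : ∃ C, LipschitzWith C (ramp (n := n) R ε) := by
  have h1 : LipschitzWith (0 + 1) fun x : Rn n => R - ‖x‖ :=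
    (LipschitzWith.const R).sub lipschitzWith_one_norm
  have h2 : LipschitzWith (‖ε⁻¹‖₊ * (0 + 1)) fun x : Rn n => ε⁻¹ * (R - ‖x‖) :=
    (lipschitzWith_smul ε⁻¹).comp h1
  exact ⟨_, (h2.const_min 1).const_max 0⟩

theorem ramp_nonneg (R ε : ℝ) (x : Rn n) : 0 ≤ ramp R ε x := le_max_left _ _

theorem ramp_le_one (R ε : ℝ) (x : Rn n) : ramp R ε x ≤ 1 :=
  max_le zero_le_one (min_le_left _ _)

theorem ramp_eq_zero {R ε : ℝ} (hε : 0 < ε) {x : Rn n} (hx : R ≤ ‖x‖) : ramp R ε x = 0 := by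
  refine max_eq_left ((min_le_right _ _).trans ?_)
  exact mul_nonpos_of_nonneg_of_nonpos (inv_pos.2 hε).le (by linarith)

theorem ramp_eq_one {R ε : ℝ} (hε : 0 < ε) {x : Rn n} (hx : ‖x‖ ≤ R - ε) : ramp R ε x = 1 := by
  have : 1 ≤ ε⁻¹ * (R - ‖x‖) := by
    rw [inv_mul_eq_div, le_div_iff₀ hε]
    linarith
  rw [ramp, min_eq_left this, max_eq_right zero_le_one]

theorem fderiv_ramp_apply {R ε : ℝ} (hε : 0 < ε) (hεR : ε < R) {x : Rn n}
    (h1 : ‖x‖ ≠ R) (h2 : ‖x‖ ≠ R - ε) (v : Rn n) :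
    fderiv ℝ (ramp R ε) x v =
      -((ball (0 : Rn n) R \ ball 0 (R - ε)).indicator
        (fun x => ε⁻¹ * inner ℝ v (‖x‖⁻¹ • x)) x) := by
  rcases lt_or_gt_of_ne h2 with h | h
  · have : ramp R ε =ᶠ[𝓝 x] fun _ => 1 := by
      filter_upwards [continuous_norm.continuousAt.eventually_lt continuousAt_const h] with y hy
        using ramp_eq_one hε hy.le
    rw [this.fderiv_eq, indicator_of_notMem]
    · simp
    · simp [h]
  rcases lt_or_gt_of_ne h1 with h' | h'
  · have : ramp R ε =ᶠ[𝓝 x] fun y => ε⁻¹ * (R - ‖y‖) := by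
      filter_upwards [continuous_norm.continuousAt.eventually_lt continuousAt_const h',
        continuousAt_const.eventually_lt continuous_norm.continuousAt h] with y hy hy'
      rw [ramp, min_eq_right, max_eq_right]
      · exact mul_nonneg (inv_pos.2 hε).le (by linarith)
      · rw [inv_mul_eq_div, div_le_one hε]
        linarith
    have hx0 : x ≠ 0 := by
      rintro rfl
      rw [norm_zero] at h
      linarith
    have hnorm : HasFDerivAt (fun y : Rn n => ‖y‖) (‖x‖⁻¹ • innerSL ℝ x : Rn n →L[ℝ] ℝ) x := by
      have hs := ((hasFDerivAt_id x).norm_sq).sqrt (by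
        simpa using hx0)
      have hs' : (fun y : Rn n => √(‖id y‖ ^ 2)) = fun y => ‖y‖ := by
        ext y
        exact Real.sqrt_sq (norm_nonneg _)
      rw [hs'] at hs
      refine hs.congr_fderiv ?_
      ext w
      simp
      field_simp
    rw [this.fderiv_eq, ((hnorm.const_sub R).const_mul ε⁻¹).fderiv, indicator_of_mem]
    · simp [inner_smul_right, real_inner_comm]
    · simp [h', h.le]
  · have : ramp R ε =ᶠ[𝓝 x] fun _ => 0 := by
      filter_upwards [continuousAt_const.eventually_lt continuous_norm.continuousAt h'] with y hy
        using ramp_eq_zero hε hy.le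
    rw [this.fderiv_eq, indicator_of_notMem]
    · simp
    · simp [h'.le]

/-- The indicator of the ball is approximated by ramps, which turns the left side into an average of
⟨X,ν⟩ over a thin shell. Replacing X(x) by its value at the radial projection of x makes the
integrand homogeneous of degree 0, so its shell integral is an explicit multiple of that over the
unit ball. -/
theorem integral_divergence_ball (hn : n ≠ 0) {R : ℝ} (hR : 0 < R) {X : Rn n → Rn n}
    (hX : ContDiff ℝ 1 X) (hc : HasCompactSupport X) :
    ∫ x in ball (0 : Rn n) R, divergence X x =
      n * R ^ (n - 1) * ∫ z in ball (0 : Rn n) 1, inner ℝ (X (R • (‖z‖⁻¹ • z))) (‖z‖⁻¹ • z) := by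
  have : Nonempty (Fin n) := Fin.pos_iff_nonempty.1 (Nat.pos_of_ne_zero hn)
  obtain ⟨D, hD⟩ := hX.lipschitzWith_of_hasCompactSupport hc one_ne_zero
  obtain ⟨M, hM⟩ := hX.continuous.bounded_above_of_compact_support hc
  have hXm := hX.continuous.measurable
  set ν : Rn n → Rn n := fun z => ‖z‖⁻¹ • z with hν
  have hνm : Measurable ν := by fun_prop
  have hνle : ∀ z, ‖ν z‖ ≤ 1 := fun z => by
    rw [hν, norm_smul, norm_inv, norm_norm]
    exact inv_mul_le_one
  set h : Rn n → ℝ := fun z => inner ℝ (X (R • ν z)) (ν z) with hh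
  have hbd : ∀ (Y : Rn n → Rn n), (∀ z, ‖Y z‖ ≤ M) → ∀ z, ‖(inner ℝ (Y z) (ν z) : ℝ)‖ ≤ M :=
    fun Y hY z => by
      refine (norm_inner_le_norm _ _).trans ?_
      calc _ ≤ M * 1 := mul_le_mul (hY z) (hνle z) (norm_nonneg _) ((norm_nonneg _).trans (hY z))
        _ = M := mul_one M
  have hhm : Measurable h := (hXm.comp (hνm.const_smul R)).inner hνm
  have hgm : Measurable fun z => (inner ℝ (X z) (ν z) : ℝ) := hXm.inner hνm
  have hhint : ∀ s : Set (Rn n), volume s < ⊤ → IntegrableOn h s := fun s hs =>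
    IntegrableOn.of_bound hs hhm.aestronglyMeasurable M
      (ae_of_all _ (hbd _ fun z => hM _))
  have hgint : ∀ s : Set (Rn n), volume s < ⊤ →
      IntegrableOn (fun z => (inner ℝ (X z) (ν z) : ℝ)) s := fun s hs =>
    IntegrableOn.of_bound hs hgm.aestronglyMeasurable M (ae_of_all _ (hbd _ hM))
  have hhom : ∀ ρ : ℝ, 0 < ρ → ∫ z in ball (0 : Rn n) ρ, h z = ρ ^ n * ∫ z in ball 0 1, h z := by
    intro ρ hρ
    have h1 := Measure.setIntegral_comp_smul_of_pos volume h (ball (0 : Rn n) 1) hρ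
    rw [smul_unitBall_of_pos hρ, finrank_euclideanSpace_fin] at h1
    have h2 : ∀ z, h (ρ • z) = h z := fun z => by
      have : ν (ρ • z) = ν z := by
        simp only [hν, norm_smul, Real.norm_of_nonneg hρ.le, smul_smul]
        congr 1
        field_simp
      simp only [hh, this]
    simp_rw [h2] at h1
    rw [h1, smul_eq_mul]
    field_simp
  set ε : ℕ → ℝ := fun k => R * (1 / (k + 2)) with hε
  have hε0 : ∀ k, 0 < ε k := fun k => by positivity
  have hεR : ∀ k, ε k < R := fun k => by
    simp only [hε]
    have : 1 / ((k : ℝ) + 2) < 1 := by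
      rw [div_lt_one (by positivity)]
      have : (0 : ℝ) ≤ k := Nat.cast_nonneg _
      linarith
    nlinarith
  have hεlim : Tendsto ε atTop (𝓝 0) := by
    have h1 := (tendsto_one_div_add_atTop_nhds_zero_nat (𝕜 := ℝ)).comp (tendsto_add_atTop_nat 1)
    have h2 := h1.const_mul R
    rw [mul_zero] at h2
    refine h2.congr fun k => ?_
    simp only [hε, Function.comp]
    push_cast
    ring
  set A : ℕ → Set (Rn n) := fun k => ball (0 : Rn n) R \ ball 0 (R - ε k) with hA
  have hAm : ∀ k, MeasurableSet (A k) := fun k => measurableSet_ball.diff measurableSet_ball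
  have hAfin : ∀ k, volume (A k) < ⊤ := fun k =>
    (measure_mono sdiff_subset).trans_lt measure_ball_lt_top
  have hRHS : ∀ k, ∫ x, ramp R (ε k) x * divergence X x =
      (ε k)⁻¹ * ∫ x in A k, inner ℝ (X x) (ν x) := by
    intro k
    obtain ⟨C, hC⟩ := exists_lipschitzWith_ramp (n := n) R (ε k)
    rw [integral_mul_divergence hC hX hc, ← integral_const_mul, ← integral_indicator (hAm k),
      ← integral_neg]
    refine integral_congr_ae ?_
    have hs1 : ∀ᵐ x : Rn n, x ∉ sphere (0 : Rn n) R :=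
      measure_eq_zero_iff_ae_notMem.1 (Measure.addHaar_sphere volume _ _)
    have hs2 : ∀ᵐ x : Rn n, x ∉ sphere (0 : Rn n) (R - ε k) :=
      measure_eq_zero_iff_ae_notMem.1 (Measure.addHaar_sphere volume _ _)
    filter_upwards [hs1, hs2] with x h1 h2
    rw [mem_sphere_zero_iff_norm] at h1 h2
    rw [fderiv_ramp_apply (hε0 k) (hεR k) h1 h2, neg_neg]
    rfl
  have hLHS : Tendsto (fun k => ∫ x, ramp R (ε k) x * divergence X x) atTop
      (𝓝 (∫ x in ball (0 : Rn n) R, divergence X x)) := by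
    rw [← integral_indicator measurableSet_ball]
    refine tendsto_integral_of_dominated_convergence (fun x => ‖divergence X x‖)
      (fun k => ?_) (integrable_divergence hX hc).norm (fun k => ae_of_all _ fun x => ?_)
      (ae_of_all _ fun x => ?_)
    · obtain ⟨C, hC⟩ := exists_lipschitzWith_ramp (n := n) R (ε k)
      exact (hC.continuous.mul (continuous_divergence hX)).aestronglyMeasurable
    · rw [norm_mul, Real.norm_of_nonneg (ramp_nonneg _ _ _)]
      exact mul_le_of_le_one_left (norm_nonneg _) (ramp_le_one _ _ _)
    · by_cases hx : ‖x‖ < R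
      · rw [indicator_of_mem (mem_ball_zero_iff.2 hx)]
        refine tendsto_const_nhds.congr' ?_
        filter_upwards [hεlim.eventually_lt_const (sub_pos.2 hx)] with k hk
        rw [ramp_eq_one (hε0 k) (by linarith), one_mul]
      · rw [indicator_of_notMem (by rwa [mem_ball_zero_iff])]
        refine tendsto_const_nhds.congr fun k => ?_
        rw [ramp_eq_zero (hε0 k) (not_lt.1 hx), zero_mul]
  have hAh : ∀ k, ∫ x in A k, h x = (R ^ n - (R - ε k) ^ n) * ∫ z in ball 0 1, h z := fun k => by
    rw [hA, setIntegral_sdiff measurableSet_ball (hhint _ measure_ball_lt_top)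
      (ball_subset_ball (by linarith [hε0 k])), hhom R hR, hhom (R - ε k) (sub_pos.2 (hεR k))]
    ring
  -- In the shell, x lies within ε of its projection to the sphere, so the Lipschitz error D ε
  -- cancels the factor ε⁻¹ and leaves the volume of the shell, which tends to 0.
  have hcmp : ∀ k, ‖(∫ x, ramp R (ε k) x * divergence X x) -
      (ε k)⁻¹ * (R ^ n - (R - ε k) ^ n) * ∫ z in ball 0 1, h z‖ ≤ D * volume.real (A k) := by
    intro k
    rw [hRHS, mul_assoc, ← hAh, ← mul_sub, ← integral_sub (hgint _ (hAfin k)) (hhint _ (hAfin k)),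
      Real.norm_eq_abs, abs_mul, abs_of_pos (inv_pos.2 (hε0 k)), inv_mul_le_iff₀ (hε0 k)]
    have heq : ε k * (D * volume.real (A k)) = D * ε k * volume.real (A k) := by ring
    rw [heq, ← Real.norm_eq_abs]
    refine norm_setIntegral_le_of_norm_le_const (hAfin k) fun x hx => ?_
    have hx1 : ‖x‖ < R := mem_ball_zero_iff.1 hx.1
    have hx2 : R - ε k ≤ ‖x‖ := by
      have := hx.2
      rwa [mem_ball_zero_iff, not_lt] at this
    have hx0 : 0 < ‖x‖ := by linarith [hεR k]
    simp only [hh]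
    rw [← inner_sub_left]
    refine (norm_inner_le_norm _ _).trans ((mul_le_of_le_one_right (norm_nonneg _) (hνle x)).trans ?_)
    rw [← dist_eq_norm]
    refine (hD.dist_le_mul _ _).trans (mul_le_mul_of_nonneg_left ?_ D.2)
    have h3 : x - R • ν x = (‖x‖ - R) • ν x := by
      simp only [hν, sub_smul]
      rw [smul_smul ‖x‖, mul_inv_cancel₀ hx0.ne', one_smul]
    rw [dist_eq_norm, h3, norm_smul]
    refine (mul_le_of_le_one_right (norm_nonneg _) (hνle x)).trans ?_
    rw [Real.norm_eq_abs, abs_le]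
    constructor <;> linarith [hε0 k]
  have hvol : Tendsto (fun k => D * volume.real (A k)) atTop (𝓝 0) := by
    have h1 : ∀ k, volume.real (A k) = (R ^ n - (R - ε k) ^ n) * volume.real (ball (0 : Rn n) 1) := by
      intro k
      rw [hA, measureReal_sdiff (ball_subset_ball (by linarith [hε0 k])) measurableSet_ball,
        volume_real_ball_eq _ hR, volume_real_ball_eq _ (sub_pos.2 (hεR k))]
      ring
    simp_rw [h1]
    have h2 : Tendsto (fun k => D * ((R ^ n - (R - ε k) ^ n) * volume.real (ball (0 : Rn n) 1)))
        atTop (𝓝 (D * ((R ^ n - (R - 0) ^ n) * volume.real (ball (0 : Rn n) 1)))) :=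
      (((((hεlim.const_sub R).pow n).const_sub _).mul_const _).const_mul _)
    simpa using h2
  have hcoef : Tendsto (fun k => (ε k)⁻¹ * (R ^ n - (R - ε k) ^ n)) atTop
      (𝓝 (n * R ^ (n - 1))) := by
    have h1 := (hasDerivAt_pow n R).tendsto_slope_zero
    have h2 : Tendsto (fun k => -ε k) atTop (𝓝[≠] 0) := by
      refine tendsto_nhdsWithin_iff.2 ⟨by simpa using hεlim.neg, Eventually.of_forall fun k => ?_⟩
      exact neg_ne_zero.2 (hε0 k).ne'
    refine (h1.comp h2).congr fun k => ?_
    simp only [Function.comp, smul_eq_mul, inv_neg, ← sub_eq_add_neg]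
    ring
  have hlim2 : Tendsto (fun k => ∫ x, ramp R (ε k) x * divergence X x) atTop
      (𝓝 (n * R ^ (n - 1) * ∫ z in ball (0 : Rn n) 1, h z)) := by
    have h1 := squeeze_zero_norm hcmp hvol
    have h2 := h1.add (hcoef.mul_const (∫ z in ball (0 : Rn n) 1, h z))
    simpa using h2
  exact tendsto_nhds_unique hLHS hlim2

/-- The factor n is the ratio of the area of the unit sphere to the volume of the unit ball. -/
theorem isGaussGreen_ball (hn : n ≠ 0) {R : ℝ} (hR : 0 < R) :
    IsGaussGreen (ball (0 : Rn n) R) ((n : NNReal) • sphereMeasure (0 : Rn n) R)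
      fun x => ‖x‖⁻¹ • x := by
  have hm : Measurable fun x : Rn n => ‖x‖⁻¹ • x := by fun_prop
  refine ⟨inferInstance, hm, ?_, fun X hX hc => ?_⟩
  · refine Measure.ae_smul_measure ?_ _
    have h1 : ∀ᵐ x ∂(sphereMeasure (0 : Rn n) R), x ∉ (sphere (0 : Rn n) R)ᶜ :=
      measure_eq_zero_iff_ae_notMem.1 (sphereMeasure_compl_sphere hn 0 hR)
    filter_upwards [h1] with x hx
    rw [notMem_compl_iff, mem_sphere_zero_iff_norm] at hx
    rw [norm_smul, norm_inv, norm_norm, hx, inv_mul_cancel₀ hR.ne']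
  · have : Nonempty (Fin n) := Fin.pos_iff_nonempty.1 (Nat.pos_of_ne_zero hn)
    have hXm := hX.continuous.measurable
    rw [integral_divergence_ball hn hR hX hc, integral_smul_nnreal_measure, sphereMeasure,
      integral_smul_measure, integral_map (measurable_radial 0 R).aemeasurable
        (hXm.inner hm).aestronglyMeasurable, ENNReal.toReal_ofReal (by positivity), mul_assoc,
        smul_eq_mul, NNReal.smul_def, smul_eq_mul]
    congr 2
    refine integral_congr_ae ?_
    have h0 : ∀ᵐ z : Rn n, z ∉ ({0} : Set (Rn n)) :=
      measure_eq_zero_iff_ae_notMem.1 (measure_singleton _)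
    filter_upwards [ae_restrict_of_ae h0] with z hz
    have hz0 : ‖z‖ ≠ 0 := norm_ne_zero_iff.2 hz
    simp only [zero_add]
    congr 1
    rw [norm_smul, norm_smul, norm_inv, norm_norm, inv_mul_cancel₀ hz0, mul_one,
      Real.norm_of_nonneg hR.le, smul_smul R⁻¹ R, inv_mul_cancel₀ hR.ne', one_smul]

/-- The normal x/‖x‖ is continuous at points of the sphere, so its averages over small balls
converge to its value. Only this inclusion is needed, for a lower bound of P_p(B_R). -/
theorem sphere_subset_reducedBoundary_ball (hn : n ≠ 0) {R : ℝ} (hR : 0 < R) :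
    sphere (0 : Rn n) R ⊆ reducedBoundary (ball (0 : Rn n) R) := by
  intro x hx
  have hxR : ‖x‖ = R := mem_sphere_zero_iff_norm.1 hx
  have hx0 : x ≠ 0 := norm_ne_zero_iff.1 (by rw [hxR]; exact hR.ne')
  have hG := isGaussGreen_ball hn hR
  set μ := (n : NNReal) • sphereMeasure (0 : Rn n) R with hμ
  set ν : Rn n → Rn n := fun x => ‖x‖⁻¹ • x with hν
  have hpos : ∀ ρ : ℝ, 0 < ρ → 0 < μ (ball x ρ) := by
    intro ρ hρ
    obtain ⟨c, hc, h⟩ := exists_le_sphereMeasure_ball hn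
    have h1 := h 0 x R (min ρ R) (lt_min hρ hR) (min_le_right _ _) (by simpa using hxR)
    have h2 : 0 < sphereMeasure (0 : Rn n) R (ball x ρ) :=
      (ENNReal.ofReal_pos.2 (mul_pos hc (pow_pos (lt_min hρ hR) _))).trans_le
        (h1.trans (measure_mono (ball_subset_ball (min_le_left _ _))))
    rw [hμ, Measure.smul_apply, ENNReal.smul_def, smul_eq_mul]
    exact ENNReal.mul_pos (by simpa using hn) h2.ne'
  refine ⟨μ, ν, hG, hpos, ν x, ?_, ?_⟩
  · rw [hν, norm_smul, norm_inv, norm_norm, inv_mul_cancel₀ (norm_ne_zero_iff.2 hx0)]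
  · have hcont : ContinuousAt ν x :=
      (continuousAt_id.norm.inv₀ (norm_ne_zero_iff.2 hx0)).smul continuousAt_id
    refine Metric.tendsto_nhds.2 fun ε hε => ?_
    obtain ⟨δ, hδ, h⟩ := Metric.continuousAt_iff.1 hcont (ε / 2) (half_pos hε)
    filter_upwards [Ioo_mem_nhdsGT hδ] with ρ hρ
    have h1 : ⨍ y in ball x ρ, ν y ∂μ ∈ closedBall (ν x) (ε / 2) := by
      refine (convex_closedBall _ _).set_average_mem isClosed_closedBall (hpos ρ hρ.1).ne'
        (measure_ne_top _ _) ?_ ?_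
      · filter_upwards [ae_restrict_mem measurableSet_ball] with y hy
        exact (h (lt_trans (mem_ball.1 hy) hρ.2)).le
      · refine IntegrableOn.of_bound (measure_lt_top _ _) hG.measurable.aestronglyMeasurable 1
          (ae_restrict_of_ae ?_)
        filter_upwards [hG.norm_eq_one] with y hy using hy.le
    exact (mem_closedBall.1 h1).trans_lt (half_lt_self hε)

end BallGaussGreen

/-! ### Finite perimeter of a countable union of balls. -/

section FinitePerimeter

variable {n : ℕ}

/-- The function `1 - ∏_{i < N} (1 - u i)`. -/
noncomputable def probSum (u : ℕ → Rn n → ℝ) : ℕ → Rn n → ℝ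
  | 0 => fun _ => 0
  | N + 1 => fun x => probSum u N x + (1 - probSum u N x) * u N x

variable {u : ℕ → Rn n → ℝ}

theorem probSum_mem_Icc (h0 : ∀ i x, 0 ≤ u i x) (h1 : ∀ i x, u i x ≤ 1) (N : ℕ) (x : Rn n) :
    0 ≤ probSum u N x ∧ probSum u N x ≤ 1 := by
  induction N with
  | zero => simp [probSum]
  | succ N ih =>
    simp only [probSum]
    constructor <;> nlinarith [h0 N x, h1 N x, mul_nonneg (sub_nonneg.2 ih.2) (h0 N x),
      mul_nonneg (sub_nonneg.2 ih.2) (sub_nonneg.2 (h1 N x))]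

theorem contDiff_probSum (hu : ∀ i, ContDiff ℝ 1 (u i)) (N : ℕ) : ContDiff ℝ 1 (probSum u N) := by
  induction N with
  | zero => exact contDiff_const
  | succ N ih => exact ih.add ((contDiff_const.sub ih).mul (hu N))

theorem hasCompactSupport_probSum (hu : ∀ i, HasCompactSupport (u i)) (N : ℕ) :
    HasCompactSupport (probSum u N) := by
  induction N with
  | zero => exact HasCompactSupport.zero
  | succ N ih => exact ih.add (hu N).mul_left

theorem probSum_eq_zero {x : Rn n} (h : ∀ i, u i x = 0) (N : ℕ) : probSum u N x = 0 := by
  induction N with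
  | zero => rfl
  | succ N ih => simp [probSum, ih, h]

theorem probSum_eq_one {x : Rn n} {i N : ℕ} (hi : i < N) (h : u i x = 1) : probSum u N x = 1 := by
  induction N with
  | zero => omega
  | succ N ih =>
    rcases Nat.lt_succ_iff_lt_or_eq.1 hi with h' | rfl
    · simp [probSum, ih h']
    · simp [probSum, h]

/-- The derivative of P + (1-P)u is (1-u)∇P + (1-P)∇u with both coefficients in [0,1], so overlaps
of the balls cost nothing. -/
theorem norm_fderiv_probSum_le (hu : ∀ i, ContDiff ℝ 1 (u i)) (h0 : ∀ i x, 0 ≤ u i x)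
    (h1 : ∀ i x, u i x ≤ 1) (N : ℕ) (x : Rn n) :
    ‖fderiv ℝ (probSum u N) x‖ ≤ ∑ i ∈ Finset.range N, ‖fderiv ℝ (u i) x‖ := by
  induction N with
  | zero => simp [probSum]
  | succ N ih =>
    have hf := ((contDiff_probSum hu N).differentiable one_ne_zero x).hasFDerivAt
    have hg := ((hu N).differentiable one_ne_zero x).hasFDerivAt
    have h := hf.fun_add ((hf.const_sub 1).fun_mul hg)
    have hx : HasFDerivAt (probSum u (N + 1)) ((1 - u N x) • fderiv ℝ (probSum u N) x +
        (1 - probSum u N x) • fderiv ℝ (u N) x) x := by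
      refine h.congr_fderiv ?_
      ext v
      simp
      ring
    have hm := probSum_mem_Icc h0 h1 N x
    rw [hx.fderiv, Finset.sum_range_succ]
    refine (norm_add_le _ _).trans (add_le_add ?_ ?_)
    · rw [norm_smul, Real.norm_of_nonneg (sub_nonneg.2 (h1 N x))]
      exact (mul_le_of_le_one_left (norm_nonneg _) (by linarith [h0 N x])).trans ih
    · rw [norm_smul, Real.norm_of_nonneg (sub_nonneg.2 hm.2)]
      exact mul_le_of_le_one_left (norm_nonneg _) (by linarith [hm.1])

theorem integrable_norm_fderiv_cutoff (a : Rn n) {s t : ℝ} (hs : 0 ≤ s) (hst : s < t) :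
    Integrable fun x => ‖fderiv ℝ (cutoff a s t) x‖ :=
  ((contDiff_cutoff (m := 1)).continuous_fderiv one_ne_zero).norm.integrable_of_hasCompactSupport
    ((hasCompactSupport_cutoff hs hst).fderiv (𝕜 := ℝ)).norm

/-- The gradient bound 2K/(t-s) is compensated by the volume of the annulus, at most n
t^{n-1}(t-s)|B_1|; the result stays bounded as s tends to t. -/
theorem exists_integral_norm_fderiv_cutoff_le (n : ℕ) :
    ∃ B : ℝ, 0 < B ∧ ∀ (a : Rn n) (s t : ℝ), 0 < s → s < t →
      ∫ x, ‖fderiv ℝ (cutoff a s t) x‖ ≤ B * t ^ (n - 1) := by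
  obtain ⟨K, hK0, hK⟩ := exists_deriv_smoothTransition_bound
  set ω := volume.real (ball (0 : Rn n) 1) with hω
  have hω0 : 0 ≤ ω := measureReal_nonneg
  refine ⟨2 * K * n * ω + 1, by positivity, fun a s t hs hst => ?_⟩
  have ht : 0 < t := hs.trans hst
  have hts : 0 < t - s := sub_pos.2 hst
  have h1 : ∫ x, ‖fderiv ℝ (cutoff a s t) x‖ =
      ∫ x in ball a t \ ball a s, ‖fderiv ℝ (cutoff a s t) x‖ := by
    rw [setIntegral_eq_integral_of_forall_compl_eq_zero fun x hx => ?_]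
    rw [fderiv_cutoff_eq_zero hs.le hst, norm_zero]
    by_contra! hcon
    refine hx ⟨by rw [mem_ball, dist_eq_norm]; exact hcon.2, fun h2 => ?_⟩
    rw [mem_ball, dist_eq_norm] at h2
    linarith [hcon.1]
  have h2 : volume.real (ball a t \ ball a s) = (t ^ n - s ^ n) * ω := by
    rw [measureReal_sdiff (ball_subset_ball hst.le) measurableSet_ball, volume_real_ball_eq a ht,
      volume_real_ball_eq a hs]
    ring
  have h3 : t ^ n - s ^ n ≤ n * t ^ (n - 1) * (t - s) := by
    have hg := (Commute.all t s).mul_geom_sum₂ n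
    rw [← hg, mul_comm]
    refine mul_le_mul_of_nonneg_right ?_ hts.le
    calc _ ≤ ∑ i ∈ Finset.range n, t ^ (n - 1) := by
          refine Finset.sum_le_sum fun i hi => ?_
          have hi' := Finset.mem_range.1 hi
          calc t ^ i * s ^ (n - 1 - i) ≤ t ^ i * t ^ (n - 1 - i) := by gcongr
            _ = t ^ (n - 1) := by rw [← pow_add]; congr 1; omega
      _ = _ := by simp
  rw [h1]
  refine (Real.le_norm_self _).trans ((norm_setIntegral_le_of_norm_le_const
    ((measure_mono sdiff_subset).trans_lt measure_ball_lt_top) fun x _ => by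
      rw [norm_norm]; exact norm_fderiv_cutoff_le hK hs.le hst x).trans ?_)
  rw [h2]
  calc 2 * K / (t - s) * ((t ^ n - s ^ n) * ω)
      ≤ 2 * K / (t - s) * ((n * t ^ (n - 1) * (t - s)) * ω) := by gcongr
    _ = (2 * K * n * ω) * t ^ (n - 1) := by field_simp
    _ ≤ _ := by gcongr; linarith

/-- Smooth functions f_N converge pointwise to the indicator of the union, and their gradients are
bounded in L¹ by a multiple of Σ r_i^{n-1}; integration by parts against X passes to the limit. -/
theorem hasFinitePerimeter_iUnion_ball (q : ℕ → Rn n) {r : ℕ → ℝ} (hr : ∀ i, 0 < r i)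
    (hs : Summable fun i => r i ^ (n - 1)) : HasFinitePerimeter (⋃ i, ball (q i) (r i)) := by
  have hEo : IsOpen (⋃ i, ball (q i) (r i)) := isOpen_iUnion fun i => isOpen_ball
  refine ⟨hEo.measurableSet.nullMeasurableSet, ?_⟩
  obtain ⟨B, hB0, hB⟩ := exists_integral_norm_fderiv_cutoff_le n
  -- The shift by 2 keeps the inner radii r_i k_N positive also for N = 0.
  set k : ℕ → ℝ := fun N => 1 - 1 / ((N : ℝ) + 2) with hk
  have hk0 : ∀ N, 0 < k N := fun N => by
    have : 1 / ((N : ℝ) + 2) < 1 := by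
      rw [div_lt_one (by positivity)]
      have : (0 : ℝ) ≤ N := Nat.cast_nonneg _
      linarith
    simp only [hk]
    linarith
  have hk1 : ∀ N, k N < 1 := fun N => by
    have : 0 < 1 / ((N : ℝ) + 2) := by positivity
    simp only [hk]
    linarith
  have hklim : Tendsto k atTop (𝓝 1) := by
    have h1 := (tendsto_one_div_add_atTop_nhds_zero_nat (𝕜 := ℝ)).comp (tendsto_add_atTop_nat 1)
    have h2 := h1.const_sub 1
    rw [sub_zero] at h2
    refine h2.congr fun k => ?_
    simp only [hk, Function.comp]
    push_cast
    ring
  set u : ℕ → ℕ → Rn n → ℝ := fun N i => cutoff (q i) (r i * k N) (r i) with hu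
  have hs0 : ∀ N i, 0 < r i * k N := fun N i => mul_pos (hr i) (hk0 N)
  have hst : ∀ N i, r i * k N < r i := fun N i => mul_lt_of_lt_one_right (hr i) (hk1 N)
  have hu1 : ∀ N i, ContDiff ℝ 1 (u N i) := fun N i => contDiff_cutoff (m := 1)
  have huc : ∀ N i, HasCompactSupport (u N i) := fun N i =>
    hasCompactSupport_cutoff (hs0 N i).le (hst N i)
  set f : ℕ → Rn n → ℝ := fun N => probSum (u N) N with hf
  have hf1 : ∀ N, ContDiff ℝ 1 (f N) := fun N => contDiff_probSum (hu1 N) N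
  have hfm : ∀ N x, 0 ≤ f N x ∧ f N x ≤ 1 := fun N x =>
    probSum_mem_Icc (fun i => cutoff_nonneg) (fun i => cutoff_le_one) N x
  have hbound : ∀ X : Rn n → Rn n, ContDiff ℝ 1 X → HasCompactSupport X → (∀ x, ‖X x‖ ≤ 1) →
      ∫ x in ⋃ i, ball (q i) (r i), divergence X x ≤ B * ∑' i, r i ^ (n - 1) := by
    intro X hX hc hX1
    have hlim : Tendsto (fun N => ∫ x, f N x * divergence X x) atTop
        (𝓝 (∫ x in ⋃ i, ball (q i) (r i), divergence X x)) := by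
      rw [← integral_indicator hEo.measurableSet]
      refine tendsto_integral_of_dominated_convergence (fun x => ‖divergence X x‖)
        (fun N => ((hf1 N).continuous.mul (continuous_divergence hX)).aestronglyMeasurable)
        (integrable_divergence hX hc).norm (fun N => ae_of_all _ fun x => ?_)
        (ae_of_all _ fun x => ?_)
      · rw [norm_mul, Real.norm_of_nonneg (hfm N x).1]
        exact mul_le_of_le_one_left (norm_nonneg _) (hfm N x).2
      · by_cases hx : x ∈ ⋃ i, ball (q i) (r i)
        · rw [indicator_of_mem hx]
          obtain ⟨i, hi⟩ := mem_iUnion.1 hx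
          rw [mem_ball, dist_eq_norm] at hi
          have h1 : ∀ᶠ N in atTop, ‖x - q i‖ < r i * k N := by
            refine Tendsto.eventually_const_lt (u := ‖x - q i‖) (v := r i * 1) (by simpa)
              (hklim.const_mul _)
          refine tendsto_const_nhds.congr' ?_
          filter_upwards [h1, eventually_gt_atTop i] with N hN hiN
          have : f N x = 1 := probSum_eq_one hiN (cutoff_eq_one (hs0 N i).le (hst N i) hN.le)
          rw [this, one_mul]
        · rw [indicator_of_notMem hx]
          refine tendsto_const_nhds.congr fun N => ?_
          have : f N x = 0 := probSum_eq_zero (fun i => cutoff_eq_zero (hs0 N i).le (hst N i) (by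
            by_contra! hlt
            exact hx (mem_iUnion.2 ⟨i, by rwa [mem_ball, dist_eq_norm]⟩))) N
          rw [this, zero_mul]
    refine le_of_tendsto' hlim fun N => ?_
    obtain ⟨C, hC⟩ := (hf1 N).lipschitzWith_of_hasCompactSupport
      (hasCompactSupport_probSum (huc N) N) one_ne_zero
    rw [integral_mul_divergence hC hX hc]
    have hint : ∀ i, Integrable fun x => ‖fderiv ℝ (u N i) x‖ := fun i =>
      integrable_norm_fderiv_cutoff _ (hs0 N i).le (hst N i)
    calc -∫ x, fderiv ℝ (f N) x (X x) ≤ ‖∫ x, fderiv ℝ (f N) x (X x)‖ := by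
          rw [Real.norm_eq_abs]
          exact neg_le_abs _
      _ ≤ ∫ x, ∑ i ∈ Finset.range N, ‖fderiv ℝ (u N i) x‖ := by
          refine norm_integral_le_of_norm_le (integrable_finsetSum _ fun i _ => hint i)
            (ae_of_all _ fun x => ?_)
          refine ((fderiv ℝ (f N) x).le_opNorm _).trans
            ((mul_le_of_le_one_right (norm_nonneg _) (hX1 x)).trans ?_)
          exact norm_fderiv_probSum_le (hu1 N) (fun i => cutoff_nonneg) (fun i => cutoff_le_one) N x
      _ = ∑ i ∈ Finset.range N, ∫ x, ‖fderiv ℝ (u N i) x‖ :=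
          integral_finsetSum _ fun i _ => hint i
      _ ≤ ∑ i ∈ Finset.range N, B * r i ^ (n - 1) :=
          Finset.sum_le_sum fun i _ => hB _ _ _ (hs0 N i) (hst N i)
      _ = B * ∑ i ∈ Finset.range N, r i ^ (n - 1) := by rw [Finset.mul_sum]
      _ ≤ _ := by
          refine mul_le_mul_of_nonneg_left ?_ hB0.le
          exact hs.sum_le_tsum _ fun i _ => pow_nonneg (hr i).le _
  unfold perimeter
  refine (iSup₂_le fun X hX => iSup₂_le fun hc hX1 => ?_).trans_lt
    (ENNReal.ofReal_lt_top (r := B * ∑' i, r i ^ (n - 1)))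
  exact ENNReal.ofReal_le_ofReal (hbound X hX hc hX1)

end FinitePerimeter

/-! ### The reduced boundary of a union of balls is carried by the spheres. -/

section UnionOfBalls

variable {n : ℕ}

theorem IsOpen.subset_densityPoints_one {E : Set (Rn n)} (hE : IsOpen E) : E ⊆ densityPoints E 1 := by
  intro x hx
  obtain ⟨δ, hδ, hsub⟩ := Metric.isOpen_iff.1 hE x hx
  refine tendsto_const_nhds.congr' ?_
  filter_upwards [Ioo_mem_nhdsGT hδ] with ρ hρ
  rw [inter_eq_right.2 ((ball_subset_ball hρ.2.le).trans hsub), div_self]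
  exact (ENNReal.toReal_pos (measure_ball_pos _ _ hρ.1).ne' measure_ball_lt_top.ne).ne'

/-- The lower density estimate applies to the complement, which has no volume near an interior point
of E. -/
theorem disjoint_reducedBoundary_of_isOpen (hn : 2 ≤ n) {E : Set (Rn n)} (hE : IsOpen E) :
    Disjoint (reducedBoundary E) E := by
  refine Set.disjoint_left.2 fun x hx hxE => ?_
  obtain ⟨κ, hκ, h⟩ := exists_lower_density_reducedBoundary hn
  obtain ⟨t₀, ht₀, ht⟩ := h Eᶜ hE.measurableSet.compl x
    (reducedBoundary_subset_compl hE.measurableSet hx)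
  obtain ⟨δ, hδ, hsub⟩ := Metric.isOpen_iff.1 hE x hxE
  have h1 := ht (min t₀ δ) (lt_min ht₀ hδ) (min_le_left _ _)
  have h2 : Eᶜ ∩ ball x (min t₀ δ) = ∅ := by
    rw [← disjoint_iff_inter_eq_empty, disjoint_compl_left_iff_subset]
    exact (ball_subset_ball (min_le_right _ _)).trans hsub
  rw [h2, measureReal_empty] at h1
  have := mul_pos hκ (pow_pos (lt_min ht₀ hδ) n)
  linarith

theorem notMem_reducedBoundary_of_density_zero (hn : 2 ≤ n) {E : Set (Rn n)}
    (hE : MeasurableSet E) {x : Rn n} (hx : x ∈ densityPoints E 0) : x ∉ reducedBoundary E := by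
  intro hxr
  obtain ⟨κ, hκ, h⟩ := exists_lower_density_reducedBoundary hn
  obtain ⟨t₀, ht₀, ht⟩ := h E hE x hxr
  have hω : 0 < volume.real (ball (0 : Rn n) 1) :=
    ENNReal.toReal_pos (measure_ball_pos _ _ one_pos).ne' measure_ball_lt_top.ne
  have h1 : κ / volume.real (ball (0 : Rn n) 1) ≤ 0 := by
    refine ge_of_tendsto hx ?_
    filter_upwards [Ioo_mem_nhdsGT ht₀] with ρ hρ
    rw [volume_real_ball_eq x hρ.1, div_le_div_iff₀ hω (mul_pos (pow_pos hρ.1 n) hω), ← mul_assoc]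
    exact mul_le_mul_of_nonneg_right (ht ρ hρ.1 hρ.2.le) hω.le
  have := div_pos hκ hω
  linarith

/-- A ball smaller than t that meets B_t(x) has its whole sphere within 3t of x, and r^n ≤ t
r^{n-1}. -/
theorem volume_ball_inter_le {q x : Rn n} (hn : n ≠ 0) {r t : ℝ} (hr : 0 < r) (hrt : r < t)
    (hne : (ball q r ∩ ball x t).Nonempty) :
    volume (ball q r ∩ ball x t) ≤ ENNReal.ofReal t * sphereMeasure q r (closedBall x (3 * t)) := by
  obtain ⟨z, hz1, hz2⟩ := hne
  rw [mem_ball] at hz1 hz2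
  have hsub : sphere q r ⊆ closedBall x (3 * t) := fun y hy => by
    rw [mem_sphere] at hy
    rw [mem_closedBall]
    have h1 := dist_triangle4 y q z x
    rw [dist_comm q z] at h1
    linarith
  have h1 : sphereMeasure q r (closedBall x (3 * t)) = sphereMeasure q r univ := by
    refine measure_congr ?_
    have h2 : ∀ᵐ y ∂(sphereMeasure q r), y ∉ (sphere q r)ᶜ :=
      measure_eq_zero_iff_ae_notMem.1 (sphereMeasure_compl_sphere hn q hr)
    filter_upwards [h2] with y hy
    rw [notMem_compl_iff] at hy
    exact propext ⟨fun _ => mem_univ y, fun _ => hsub hy⟩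
  rw [h1, sphereMeasure_univ, ← mul_assoc, ← ENNReal.ofReal_mul (by linarith)]
  refine (measure_mono inter_subset_left).trans ?_
  rw [volume_ball_eq q hr]
  gcongr
  calc r ^ n = r * r ^ (n - 1) := by rw [← pow_succ', Nat.sub_add_cancel (by omega)]
    _ ≤ t * r ^ (n - 1) := by gcongr

theorem exists_sphere_dist_lt {q x z : Rn n} {r t : ℝ} (hr : 0 < r) (hx : r ≤ dist x q)
    (hz : dist z q < r) (hzx : dist z x < t) : ∃ y, dist y q = r ∧ dist y x < t := by
  set d := dist x q with hd
  have hd0 : 0 < d := hr.trans_le hx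
  have hxq : ‖x - q‖ = d := (dist_eq_norm x q).symm
  refine ⟨q + (r / d) • (x - q), ?_, ?_⟩
  · rw [dist_eq_norm, add_sub_cancel_left, norm_smul, hxq, Real.norm_of_nonneg (by positivity)]
    field_simp
  · have h1 : q + (r / d) • (x - q) - x = (r / d - 1) • (x - q) := by
      rw [sub_smul, one_smul]
      abel
    have h2 : r / d - 1 ≤ 0 := by
      rw [sub_nonpos, div_le_one hd0]
      exact hx
    rw [dist_eq_norm, h1, norm_smul, hxq, Real.norm_of_nonpos h2]
    have h3 : -(r / d - 1) * d = d - r := by field_simp; ring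
    rw [h3]
    have := dist_triangle_left x q z
    linarith

variable {q : ℕ → Rn n} {r : ℕ → ℝ}

theorem isFiniteMeasure_sum_sphereMeasure (hr : ∀ i, 0 < r i)
    (hs : Summable fun i => r i ^ (n - 1)) :
    IsFiniteMeasure (Measure.sum fun i => sphereMeasure (q i) (r i)) := by
  refine ⟨?_⟩
  rw [Measure.sum_apply _ MeasurableSet.univ]
  simp_rw [sphereMeasure_univ]
  rw [ENNReal.tsum_mul_right, ← ENNReal.ofReal_tsum_of_nonneg (fun i => pow_nonneg (hr i).le _) hs]
  exact ENNReal.mul_lt_top ENNReal.ofReal_lt_top measure_ball_lt_top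

/-- Two cases. If a ball of radius at least t meets B_t(x), then since x lies outside it its sphere
passes within t of x and contributes order t^{n-1}. Otherwise all balls meeting B_t(x) are small,
and their volume, at least κt^n by the lower density, is at most t times the mass of their spheres
in B_{3t}(x). -/
theorem exists_sum_sphereMeasure_lower_bound (hn : 2 ≤ n) :
    ∃ c : ℝ, 0 < c ∧ ∀ (q : ℕ → Rn n) (r : ℕ → ℝ), (∀ i, 0 < r i) →
      ∀ x ∈ reducedBoundary (⋃ i, ball (q i) (r i)), ∃ t₀ : ℝ, 0 < t₀ ∧ ∀ t, 0 < t → t ≤ t₀ →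
        ENNReal.ofReal (c * t ^ (n - 1)) ≤
          Measure.sum (fun i => sphereMeasure (q i) (r i)) (closedBall x (3 * t)) := by
  have hn0 : n ≠ 0 := by omega
  obtain ⟨κ, hκ, hlow⟩ := exists_lower_density_reducedBoundary hn
  obtain ⟨c, hc, hsph⟩ := exists_le_sphereMeasure_ball hn0
  refine ⟨min c κ, lt_min hc hκ, fun q r hr x hx => ?_⟩
  have hEo : IsOpen (⋃ i, ball (q i) (r i)) := isOpen_iUnion fun i => isOpen_ball
  have hxE := Set.disjoint_left.1 (disjoint_reducedBoundary_of_isOpen hn hEo) hx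
  obtain ⟨t₀, ht₀, ht⟩ := hlow _ hEo.measurableSet x hx
  refine ⟨t₀, ht₀, fun t h0 h1 => ?_⟩
  have hsum := Measure.le_sum_apply (fun i => sphereMeasure (q i) (r i)) (closedBall x (3 * t))
  by_cases hbig : ∃ i, t ≤ r i ∧ (ball (q i) (r i) ∩ ball x t).Nonempty
  · obtain ⟨i, hi, z, hz1, hz2⟩ := hbig
    have hxi : r i ≤ dist x (q i) := by
      by_contra! hlt
      exact hxE (mem_iUnion.2 ⟨i, hlt⟩)
    obtain ⟨y, hy1, hy2⟩ := exists_sphere_dist_lt (hr i) hxi hz1 hz2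
    calc ENNReal.ofReal (min c κ * t ^ (n - 1)) ≤ ENNReal.ofReal (c * t ^ (n - 1)) := by
          gcongr
          exact min_le_left _ _
      _ ≤ sphereMeasure (q i) (r i) (ball y t) := hsph _ _ _ _ h0 hi hy1
      _ ≤ sphereMeasure (q i) (r i) (closedBall x (3 * t)) := by
          refine measure_mono fun w hw => ?_
          rw [mem_ball] at hw
          rw [mem_closedBall]
          linarith [dist_triangle w y x]
      _ ≤ ∑' i, sphereMeasure (q i) (r i) (closedBall x (3 * t)) := ENNReal.le_tsum i
      _ ≤ _ := hsum
  · push Not at hbig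
    have hterm : ∀ i, volume (ball (q i) (r i) ∩ ball x t) ≤
        ENNReal.ofReal t * sphereMeasure (q i) (r i) (closedBall x (3 * t)) := fun i => by
      rcases (ball (q i) (r i) ∩ ball x t).eq_empty_or_nonempty with h | h
      · rw [h, measure_empty]
        exact bot_le
      · refine volume_ball_inter_le hn0 (hr i) ?_ h
        by_contra! hle
        exact h.ne_empty (hbig i hle)
    have h2 : ENNReal.ofReal (κ * t ^ n) ≤ ENNReal.ofReal t *
        Measure.sum (fun i => sphereMeasure (q i) (r i)) (closedBall x (3 * t)) := by
      calc ENNReal.ofReal (κ * t ^ n) ≤ volume ((⋃ i, ball (q i) (r i)) ∩ ball x t) := by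
            refine ENNReal.ofReal_le_of_le_toReal (ht t h0 h1)
        _ ≤ ∑' i, volume (ball (q i) (r i) ∩ ball x t) := by
            rw [iUnion_inter]
            exact measure_iUnion_le _
        _ ≤ ∑' i, ENNReal.ofReal t * sphereMeasure (q i) (r i) (closedBall x (3 * t)) :=
            ENNReal.tsum_le_tsum hterm
        _ ≤ _ := by
            rw [ENNReal.tsum_mul_left]
            gcongr
    have h3 : κ * t ^ n = t * (κ * t ^ (n - 1)) := by
      rw [mul_left_comm, ← pow_succ', Nat.sub_add_cancel (by omega)]
    rw [h3, ENNReal.ofReal_mul h0.le, ENNReal.mul_le_mul_iff_right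
      (ENNReal.ofReal_pos.2 h0).ne' ENNReal.ofReal_ne_top] at h2
    refine le_trans ?_ h2
    gcongr
    exact min_le_right _ _

theorem euclideanHausdorffMeasure_reducedBoundary_diff_iUnion_sphere (hn : 2 ≤ n)
    (hr : ∀ i, 0 < r i) (hs : Summable fun i => r i ^ (n - 1)) :
    Measure.euclideanHausdorffMeasure (n - 1)
      (reducedBoundary (⋃ i, ball (q i) (r i)) \ ⋃ i, sphere (q i) (r i)) = 0 := by
  have hn0 : n ≠ 0 := by omega
  obtain ⟨c, hc, hlow⟩ := exists_sum_sphereMeasure_lower_bound hn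
  set A := reducedBoundary (⋃ i, ball (q i) (r i)) \ ⋃ i, sphere (q i) (r i) with hA
  set m := Measure.sum fun i => sphereMeasure (q i) (r i) with hm
  have hfin : IsFiniteMeasure m := isFiniteMeasure_sum_sphereMeasure hr hs
  have hmA : m A = 0 := by
    have hmeas : MeasurableSet (⋃ i, sphere (q i) (r i))ᶜ :=
      (MeasurableSet.iUnion fun i => isClosed_sphere.measurableSet).compl
    refine measure_mono_null (t := (⋃ i, sphere (q i) (r i))ᶜ) (fun x hx => hx.2) ?_
    rw [hm, Measure.sum_apply _ hmeas, ENNReal.tsum_eq_zero]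
    exact fun i => measure_mono_null (compl_subset_compl.2 (subset_iUnion _ i))
      (sphereMeasure_compl_sphere hn0 (q i) (hr i))
  -- The lower bound c t^{n-1} is for the ball of radius ρ = 3t, hence the division by 3^{n-1}.
  set c' : ℝ := c / 3 ^ (n - 1) with hc'
  have hc'0 : 0 < c' := by positivity
  have hU : ∀ U, IsOpen U → A ⊆ U → μH[(n - 1 : ℕ)] A ≤
      ENNReal.ofReal (10 ^ (((n - 1 : ℕ) : ℝ)) / c') * m U := by
    intro U hUo hAU
    refine hausdorffMeasure_le_of_frequently_le m (Nat.cast_nonneg _) hc'0 fun x hx δ hδ => ?_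
    obtain ⟨t₀, ht₀, ht⟩ := hlow q r hr x hx.1
    obtain ⟨δ', hδ', hsub⟩ := Metric.isOpen_iff.1 hUo x (hAU hx)
    set t := min t₀ (min δ δ' / 6) with htdef
    have ht0 : 0 < t := lt_min ht₀ (by have := lt_min hδ hδ'; positivity)
    have h6 : 6 * t ≤ min δ δ' := by
      have : t ≤ min δ δ' / 6 := min_le_right _ _
      linarith
    have hd1 : 6 * t ≤ δ := h6.trans (min_le_left _ _)
    have hd2 : 6 * t ≤ δ' := h6.trans (min_le_right _ _)
    refine ⟨3 * t, by positivity, by linarith,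
      (closedBall_subset_ball (by linarith)).trans hsub, ?_⟩
    refine le_trans (le_of_eq ?_) (ht t ht0 (min_le_left _ _))
    rw [Real.rpow_natCast, mul_pow, hc']
    congr 1
    field_simp
  have hzero : μH[(n - 1 : ℕ)] A = 0 := by
    set K := ENNReal.ofReal (10 ^ (((n - 1 : ℕ) : ℝ)) / c') with hK
    have hK0 : K ≠ 0 := (ENNReal.ofReal_pos.2 (by positivity)).ne'
    refine le_antisymm (ENNReal.le_of_forall_pos_le_add fun ε hε _ => ?_) bot_le
    have hpos : m A < ε / K := by
      rw [hmA]
      exact ENNReal.div_pos (by exact_mod_cast hε.ne') ENNReal.ofReal_ne_top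
    -- Outer regularity of the finite measure m: since m(A) = 0, open neighbourhoods of A have
    -- arbitrarily small mass.
    obtain ⟨U, hAU, hUo, hUlt⟩ := A.exists_isOpen_lt_of_lt _ hpos
    rw [zero_add]
    calc _ ≤ K * m U := hU U hUo hAU
      _ ≤ K * (ε / K) := by gcongr
      _ ≤ ε := ENNReal.mul_div_le
  rw [Measure.euclideanHausdorffMeasure_def, Measure.smul_apply, hzero, smul_zero]

theorem exists_weightedPerimeter_iUnion_ball_le (hn : 2 ≤ n) :
    ∃ C : ℝ, 0 < C ∧ ∀ (p : ℝ), p < 0 → ∀ (q : ℕ → Rn n) (r a : ℕ → ℝ), (∀ i, 0 < r i) →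
      (Summable fun i => r i ^ (n - 1)) → (∀ i, 0 < a i) →
      (∀ i, ∀ x ∈ sphere (q i) (r i), a i ≤ ‖x‖) →
      weightedPerimeter p (⋃ i, ball (q i) (r i)) ≤
        ∑' i, ENNReal.ofReal (C * r i ^ (n - 1) * a i ^ p) := by
  obtain ⟨C, hC, hsph⟩ := exists_euclideanHausdorffMeasure_sphere_le (n := n) (by omega)
  refine ⟨C, hC, fun p hp q r a hr hs ha hax => ?_⟩
  unfold weightedPerimeter
  set H : Measure (Rn n) := Measure.euclideanHausdorffMeasure (n - 1) with hH
  have hnull := euclideanHausdorffMeasure_reducedBoundary_diff_iUnion_sphere (q := q) hn hr hs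
  set A := reducedBoundary (⋃ i, ball (q i) (r i)) \ ⋃ i, sphere (q i) (r i) with hA
  have hsub : reducedBoundary (⋃ i, ball (q i) (r i)) ⊆ (⋃ i, sphere (q i) (r i)) ∪ A := by
    intro x hx
    by_cases h : x ∈ ⋃ i, sphere (q i) (r i)
    · exact Or.inl h
    · exact Or.inr ⟨hx, h⟩
  calc _ ≤ ∫⁻ x in (⋃ i, sphere (q i) (r i)) ∪ A, ‖x‖ₑ ^ p ∂H := lintegral_mono_set hsub
    _ ≤ ∫⁻ x in ⋃ i, sphere (q i) (r i), ‖x‖ₑ ^ p ∂H + ∫⁻ x in A, ‖x‖ₑ ^ p ∂H :=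
        lintegral_union_le _ _ _
    _ = ∫⁻ x in ⋃ i, sphere (q i) (r i), ‖x‖ₑ ^ p ∂H := by
        rw [Measure.restrict_eq_zero.2 hnull, lintegral_zero_measure, add_zero]
    _ ≤ ∑' i, ∫⁻ x in sphere (q i) (r i), ‖x‖ₑ ^ p ∂H := lintegral_iUnion_le _ _
    _ ≤ _ := by
        refine ENNReal.tsum_le_tsum fun i => ?_
        calc _ ≤ ∫⁻ x in sphere (q i) (r i), ENNReal.ofReal (a i ^ p) ∂H := by
              refine setLIntegral_mono' isClosed_sphere.measurableSet fun x hx => ?_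
              have hx' := hax i x hx
              rw [← ofReal_norm, ENNReal.ofReal_rpow_of_pos ((ha i).trans_le hx')]
              exact ENNReal.ofReal_le_ofReal (Real.rpow_le_rpow_of_nonpos (ha i) hx' hp.le)
          _ = ENNReal.ofReal (a i ^ p) * H (sphere (q i) (r i)) := setLIntegral_const _ _
          _ ≤ ENNReal.ofReal (a i ^ p) * ENNReal.ofReal (C * r i ^ (n - 1)) := by
              gcongr
              exact hsph _ _ (hr i)
          _ = _ := by
              rw [← ENNReal.ofReal_mul (Real.rpow_nonneg (ha i).le _), mul_comm]

theorem exists_le_weightedPerimeter_ball (hn : 2 ≤ n) :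
    ∃ c : ℝ, 0 < c ∧ ∀ (p R : ℝ), 0 < R →
      ENNReal.ofReal (c * (R ^ p * R ^ (n - 1))) ≤ weightedPerimeter p (ball (0 : Rn n) R) := by
  obtain ⟨m, rfl⟩ : ∃ m, n = m + 1 := ⟨n - 1, by omega⟩
  have hω : 0 < volume.real (ball (0 : Rn m) 1) :=
    ENNReal.toReal_pos (measure_ball_pos _ _ one_pos).ne' measure_ball_lt_top.ne
  refine ⟨volume.real (ball (0 : Rn m) 1), hω, fun p R hR => ?_⟩
  unfold weightedPerimeter
  rw [Nat.add_sub_cancel]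
  set H : Measure (Rn (m + 1)) := Measure.euclideanHausdorffMeasure m with hH
  calc _ = ENNReal.ofReal (R ^ p) * volume (ball (0 : Rn m) R) := by
        rw [volume_ball_eq _ hR,
          ← ENNReal.ofReal_toReal (measure_ball_lt_top (μ := volume) (x := (0 : Rn m)) (r := 1)).ne,
          ← ENNReal.ofReal_mul (by positivity), ← ENNReal.ofReal_mul (by positivity)]
        congr 1
        rw [Measure.real]
        ring
    _ ≤ ENNReal.ofReal (R ^ p) * H (sphere (0 : Rn (m + 1)) R) := by
        gcongr
        exact volume_ball_le_euclideanHausdorffMeasure_sphere m hR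
    _ = ∫⁻ x in sphere (0 : Rn (m + 1)) R, ENNReal.ofReal (R ^ p) ∂H :=
        (setLIntegral_const _ _).symm
    _ ≤ ∫⁻ x in sphere (0 : Rn (m + 1)) R, ‖x‖ₑ ^ p ∂H := by
        refine setLIntegral_mono' isClosed_sphere.measurableSet fun x hx => ?_
        rw [← ofReal_norm, mem_sphere_zero_iff_norm.1 hx, ENNReal.ofReal_rpow_of_pos hR]
    _ ≤ _ := lintegral_mono_set (sphere_subset_reducedBoundary_ball (by omega) hR)

end UnionOfBalls

/-! ### The greedy rearrangement. -/

section Greedy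

/-- The greedy selection: `greedy P i` is the smallest `h` with `P i h` not selected before. -/
noncomputable def greedy (P : ℕ → ℕ → Prop) (i : ℕ) : ℕ :=
  sInf {h | (∀ j : Fin i, h ≠ greedy P j) ∧ P i h}
decreasing_by exact j.2

/-- Infinitely many admissible indices at each stage make the choice possible. An index that is
never chosen is eventually admissible, so from then on it bounds the minimal choices from above; but
these are infinitely many distinct numbers. -/
theorem exists_greedy_perm {P : ℕ → ℕ → Prop} (hinf : ∀ i, {h | P i h}.Infinite)
    (hev : ∀ h, ∃ i₀, ∀ i, i₀ ≤ i → P i h) :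
    ∃ σ : Equiv.Perm ℕ, ∀ i, IsLeast {h | (∀ j < i, h ≠ σ j) ∧ P i h} (σ i) := by
  set f := greedy P with hf
  have hleast : ∀ i, IsLeast {h | (∀ j < i, h ≠ f j) ∧ P i h} (f i) := by
    intro i
    have hset : {h | (∀ j : Fin i, h ≠ greedy P j) ∧ P i h} =
        {h | (∀ j < i, h ≠ f j) ∧ P i h} := by
      ext h
      exact ⟨fun hh => ⟨fun j hj => hh.1 ⟨j, hj⟩, hh.2⟩, fun hh => ⟨fun j => hh.1 j j.2, hh.2⟩⟩
    have hfi : f i = sInf {h | (∀ j < i, h ≠ f j) ∧ P i h} := by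
      rw [← hset, hf]
      conv_lhs => rw [greedy]
    have hne : {h | (∀ j < i, h ≠ f j) ∧ P i h}.Nonempty := by
      obtain ⟨h, h1, h2⟩ := (hinf i).exists_notMem_finset ((Finset.range i).image f)
      refine ⟨h, fun j hj heq => h2 ?_, h1⟩
      exact Finset.mem_image.2 ⟨j, Finset.mem_range.2 hj, heq.symm⟩
    rw [hfi]
    exact ⟨Nat.sInf_mem hne, fun h hh => Nat.sInf_le hh⟩
  have hinj : Function.Injective f := by
    intro i j hij
    rcases lt_trichotomy i j with h | h | h
    · exact absurd hij.symm ((hleast j).1.1 i h)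
    · exact h
    · exact absurd hij ((hleast i).1.1 j h)
  have hsurj : Function.Surjective f := by
    intro h
    by_contra! hne
    obtain ⟨i₀, hi₀⟩ := hev h
    have hle : ∀ i, f (i₀ + i) ≤ h := fun i =>
      (hleast (i₀ + i)).2 ⟨fun j _ => (hne j).symm, hi₀ _ (Nat.le_add_right _ _)⟩
    have hinj' : Function.Injective fun i => f (i₀ + i) := fun a b hab =>
      Nat.add_left_cancel (hinj hab)
    refine (Set.infinite_range_of_injective hinj') ((Set.finite_Iic h).subset ?_)
    rintro _ ⟨i, rfl⟩
    exact hle i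
  exact ⟨Equiv.ofBijective f ⟨hinj, hsurj⟩, hleast⟩

/-- If the open shell τ < |x| < 1 contained finitely many points of the dense sequence, it would
coincide with that finite closed set, whereas neighbourhoods in ℝⁿ are infinite. -/
theorem infinite_setOf_lt_norm {n : ℕ} (hn : n ≠ 0) {c : ℕ → Rn n}
    (hc : ball (0 : Rn n) 1 ⊆ closure (range c)) {τ : ℝ} (hτ0 : 0 ≤ τ) (hτ : τ < 1) :
    {h | τ < ‖c h‖}.Infinite := by
  intro hfin
  have : Nonempty (Fin n) := Fin.pos_iff_nonempty.1 (Nat.pos_of_ne_zero hn)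
  set V : Set (Rn n) := {x | τ < ‖x‖ ∧ ‖x‖ < 1} with hV
  have hVo : IsOpen V :=
    (isOpen_lt continuous_const continuous_norm).inter (isOpen_lt continuous_norm continuous_const)
  have hF : (V ∩ range c).Finite := by
    refine (hfin.image c).subset ?_
    rintro _ ⟨hx, h, rfl⟩
    exact ⟨h, hx.1, rfl⟩
  have hsub : V ⊆ V ∩ range c := by
    intro x hx
    have h1 : x ∈ closure (V ∩ range c) :=
      hVo.inter_closure ⟨hx, hc (mem_ball_zero_iff.2 hx.2)⟩
    rwa [hF.isClosed.closure_eq] at h1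
  obtain ⟨x, hx⟩ := exists_norm_eq (Rn n) (c := (τ + 1) / 2) (by linarith)
  have hxV : V ∈ 𝓝 x := hVo.mem_nhds ⟨by rw [hx]; linarith, by rw [hx]; linarith⟩
  exact infinite_of_mem_nhds x hxV (hF.subset hsub)

end Greedy

/-! ### Geometric sums of the radii and density at the origin. -/

section Radius

variable {n : ℕ} {r : ℝ}

theorem radius_pos (hr : 0 < r) (i : ℕ) : 0 < radius n r i :=
  div_pos hr (Real.rpow_pos_of_pos two_pos _)

theorem radius_zero : radius n r 0 = r := by simp [radius]

/-- Self-similarity: a tail of the family is a family of the same form, so volume bounds for the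
whole apply to tails. -/
theorem radius_add (i j : ℕ) : radius n r (i + j) = radius n (radius n r i) j := by
  unfold radius
  rw [div_div, ← Real.rpow_add two_pos]
  congr 2
  push_cast
  ring

theorem radius_le (hr : 0 < r) (i : ℕ) : radius n r i ≤ r :=
  div_le_self hr.le (Real.one_le_rpow one_le_two (by positivity))

theorem radius_rpow (hr : 0 < r) (β : ℝ) (i : ℕ) :
    radius n r i ^ β = r ^ β * ((2 : ℝ) ^ (-(β / n))) ^ i := by
  unfold radius
  rw [Real.div_rpow hr.le (Real.rpow_nonneg two_pos.le _), ← Real.rpow_mul two_pos.le,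
    ← Real.rpow_natCast, ← Real.rpow_mul two_pos.le, div_eq_mul_inv, ← Real.rpow_neg two_pos.le]
  congr 2
  ring

theorem two_rpow_neg_lt_one (hn : n ≠ 0) {β : ℝ} (hβ : 0 < β) : (2 : ℝ) ^ (-(β / n)) < 1 :=
  Real.rpow_lt_one_of_one_lt_of_neg one_lt_two
    (neg_lt_zero.2 (div_pos hβ (Nat.cast_pos.2 (Nat.pos_of_ne_zero hn))))

theorem hasSum_radius_rpow (hn : n ≠ 0) (hr : 0 < r) {β : ℝ} (hβ : 0 < β) :
    HasSum (fun i => radius n r i ^ β) (r ^ β * (1 - (2 : ℝ) ^ (-(β / n)))⁻¹) := by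
  simp_rw [radius_rpow hr]
  exact (hasSum_geometric_of_lt_one (Real.rpow_nonneg two_pos.le _)
    (two_rpow_neg_lt_one hn hβ)).mul_left _

theorem hasSum_radius_pow_self (hn : n ≠ 0) (hr : 0 < r) :
    HasSum (fun i => radius n r i ^ n) (2 * r ^ n) := by
  have h := hasSum_radius_rpow hn hr (β := n) (by exact_mod_cast Nat.pos_of_ne_zero hn)
  have hn' : (n : ℝ) ≠ 0 := by exact_mod_cast hn
  simp only [Real.rpow_natCast, div_self hn'] at h
  convert h using 1
  rw [Real.rpow_neg_one]
  norm_num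
  ring

theorem tendsto_radius (hn : n ≠ 0) (hr : 0 < r) : Tendsto (radius n r) atTop (𝓝 0) := by
  simpa using (hasSum_radius_rpow hn hr one_pos).summable.tendsto_atTop_zero

theorem volume_iUnion_ball_radius_le (hn : n ≠ 0) (hr : 0 < r) (q : ℕ → Rn n) :
    volume (⋃ i, ball (q i) (radius n r i)) ≤
      ENNReal.ofReal (2 * r ^ n) * volume (ball (0 : Rn n) 1) := by
  refine (measure_iUnion_le _).trans ?_
  simp_rw [fun i => volume_ball_eq (q i) (radius_pos (n := n) hr i)]
  have h := hasSum_radius_pow_self hn hr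
  rw [ENNReal.tsum_mul_right, ← ENNReal.ofReal_tsum_of_nonneg
    (fun i => pow_nonneg (radius_pos hr i).le _) h.summable, h.tsum_eq]

theorem volume_real_iUnion_ball_inter_le (hn : n ≠ 0) (hr : 0 < r) (hr1 : r ≤ 1) {α : ℝ}
    (hα : 1 ≤ α) {q : ℕ → Rn n} (hq : ∀ i, 2 * radius n r i ^ α⁻¹ < ‖q i‖) {ρ : ℝ} (hρ : 0 < ρ) :
    volume.real ((⋃ i, ball (q i) (radius n r i)) ∩ ball 0 ρ) ≤
      2 * (ρ ^ α) ^ n * volume.real (ball (0 : Rn n) 1) := by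
  have hα0 : 0 < α := by linarith
  -- As r_i ≤ r_i^{1/α}, meeting B_ρ gives 2r_i^{1/α} < |q_i| < ρ + r_i^{1/α}.
  have hmeet : ∀ i, (ball (q i) (radius n r i) ∩ ball 0 ρ).Nonempty → radius n r i < ρ ^ α := by
    rintro i ⟨z, hz1, hz2⟩
    have hi := radius_pos (n := n) hr i
    have h1 : radius n r i ≤ radius n r i ^ α⁻¹ := by
      conv_lhs => rw [← Real.rpow_one (radius n r i)]
      exact Real.rpow_le_rpow_of_exponent_ge hi ((radius_le hr i).trans hr1) (inv_le_one_of_one_le₀ hα)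
    rw [mem_ball_iff_norm'] at hz1
    rw [mem_ball_zero_iff] at hz2
    have h2 : ‖q i‖ ≤ ‖z‖ + ‖q i - z‖ := norm_le_insert' _ _
    have h3 : radius n r i ^ α⁻¹ < ρ := by linarith [hq i]
    have h4 := Real.rpow_lt_rpow (Real.rpow_nonneg hi.le _) h3 hα0
    rwa [← Real.rpow_mul hi.le, inv_mul_cancel₀ hα0.ne', Real.rpow_one] at h4
  have hex : ∃ i, radius n r i < ρ ^ α :=
    ((tendsto_radius hn hr).eventually_lt_const (Real.rpow_pos_of_pos hρ α)).exists
  classical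
  set i₀ := Nat.find hex with hi₀
  have hsub : (⋃ i, ball (q i) (radius n r i)) ∩ ball 0 ρ ⊆
      ⋃ j, ball (q (i₀ + j)) (radius n (radius n r i₀) j) := by
    rintro z ⟨hz, hzρ⟩
    obtain ⟨i, hi⟩ := mem_iUnion.1 hz
    have h1 : i₀ ≤ i := Nat.find_min' hex (hmeet i ⟨z, hi, hzρ⟩)
    refine mem_iUnion.2 ⟨i - i₀, ?_⟩
    rwa [← radius_add, Nat.add_sub_cancel' h1]
  have h1 := (measure_mono hsub).trans
    (volume_iUnion_ball_radius_le hn (radius_pos hr i₀) fun j => q (i₀ + j))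
  have h2 : radius n r i₀ ^ n ≤ (ρ ^ α) ^ n :=
    pow_le_pow_left₀ (radius_pos hr _).le (Nat.find_spec hex).le n
  have h3 := radius_pos (n := n) hr i₀
  refine (ENNReal.toReal_mono (ENNReal.mul_ne_top ENNReal.ofReal_ne_top measure_ball_lt_top.ne)
    h1).trans ?_
  rw [ENNReal.toReal_mul, ENNReal.toReal_ofReal (by positivity)]
  exact mul_le_mul_of_nonneg_right (by linarith) ENNReal.toReal_nonneg

theorem zero_mem_densityPoints_zero (hn : n ≠ 0) (hr : 0 < r) (hr1 : r ≤ 1) {α : ℝ} (hα : 1 < α)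
    {q : ℕ → Rn n} (hq : ∀ i, 2 * radius n r i ^ α⁻¹ < ‖q i‖) :
    (0 : Rn n) ∈ densityPoints (⋃ i, ball (q i) (radius n r i)) 0 := by
  have hω : 0 < volume.real (ball (0 : Rn n) 1) :=
    ENNReal.toReal_pos (measure_ball_pos _ _ one_pos).ne' measure_ball_lt_top.ne
  have hlim : Tendsto (fun ρ : ℝ => 2 * (ρ ^ (α - 1)) ^ n) (𝓝[>] 0) (𝓝 0) := by
    have h1 : Tendsto (fun ρ : ℝ => 2 * (ρ ^ (α - 1)) ^ n) (𝓝 0) (𝓝 (2 * (0 ^ (α - 1)) ^ n)) :=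
      (((Real.continuous_rpow_const (by linarith)).tendsto 0).pow n).const_mul 2
    rw [Real.zero_rpow (by linarith), zero_pow hn, mul_zero] at h1
    exact h1.mono_left nhdsWithin_le_nhds
  refine tendsto_of_tendsto_of_tendsto_of_le_of_le' tendsto_const_nhds hlim
    (Eventually.of_forall fun ρ => div_nonneg measureReal_nonneg measureReal_nonneg) ?_
  filter_upwards [self_mem_nhdsWithin] with ρ hρ
  have hρ : 0 < ρ := hρ
  rw [volume_real_ball_eq 0 hρ, div_le_iff₀ (mul_pos (pow_pos hρ n) hω)]
  refine (volume_real_iUnion_ball_inter_le hn hr hr1 hα.le hq hρ).trans (le_of_eq ?_)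
  have h1 : (ρ ^ α) ^ n = (ρ ^ (α - 1)) ^ n * ρ ^ n := by
    rw [← mul_pow, ← Real.rpow_add_one hρ.ne', sub_add_cancel]
  rw [h1]
  ring

end Radius

/-! ### The comparison ball and the main theorem. -/

/-- The union contains one ball of radius r, and its volume is at most 2r^n|B_1| ≤ (2r)^n|B_1|. Both
bounds on R enter the comparison of perimeters. -/
theorem exists_radius_volume_eq {n : ℕ} (hn : n ≠ 0) {r : ℝ} (hr : 0 < r) (q : ℕ → Rn n) :
    ∃ R : ℝ, r ≤ R ∧ R ≤ 2 * r ∧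
      volume (⋃ i, ball (q i) (radius n r i)) = volume (ball (0 : Rn n) R) := by
  set V := volume (⋃ i, ball (q i) (radius n r i)) with hV
  set ω := volume (ball (0 : Rn n) 1) with hω
  have hω0 : ω ≠ 0 := (measure_ball_pos _ _ one_pos).ne'
  have hωt : ω ≠ ⊤ := measure_ball_lt_top.ne
  have hup : V ≤ ENNReal.ofReal (2 * r ^ n) * ω := volume_iUnion_ball_radius_le hn hr q
  have hlow : ENNReal.ofReal (r ^ n) * ω ≤ V := by
    rw [hω, ← volume_ball_eq (q 0) hr]
    refine measure_mono ?_
    have := subset_iUnion (fun i => ball (q i) (radius n r i)) 0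
    rwa [radius_zero] at this
  have hVt : V ≠ ⊤ := (hup.trans_lt (ENNReal.mul_lt_top ENNReal.ofReal_lt_top hωt.lt_top)).ne
  have hω' : 0 < ω.toReal := ENNReal.toReal_pos hω0 hωt
  set s := V.toReal / ω.toReal with hs
  have hs1 : r ^ n ≤ s := by
    rw [hs, le_div_iff₀ hω']
    have := ENNReal.toReal_mono hVt hlow
    rwa [ENNReal.toReal_mul, ENNReal.toReal_ofReal (by positivity)] at this
  have hs2 : s ≤ 2 * r ^ n := by
    rw [hs, div_le_iff₀ hω']
    have := ENNReal.toReal_mono (ENNReal.mul_ne_top ENNReal.ofReal_ne_top hωt) hup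
    rwa [ENNReal.toReal_mul, ENNReal.toReal_ofReal (by positivity)] at this
  have hs0 : 0 ≤ s := (pow_nonneg hr.le n).trans hs1
  set R := s ^ (n : ℝ)⁻¹ with hR
  have hR0 : 0 ≤ R := Real.rpow_nonneg hs0 _
  have hRn : R ^ n = s := Real.rpow_inv_natCast_pow hs0 hn
  have hrR : r ≤ R := le_of_pow_le_pow_left₀ hn hR0 (by rwa [hRn])
  refine ⟨R, hrR, ?_, ?_⟩
  · refine le_of_pow_le_pow_left₀ hn (by positivity) ?_
    rw [hRn, mul_pow]
    refine hs2.trans ?_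
    gcongr
    exact le_self_pow₀ one_le_two hn
  · rw [volume_ball_eq 0 (hr.trans_le hrR), hRn, ← hω, ← ENNReal.ofReal_toReal hωt,
      ← ENNReal.ofReal_mul hs0, hs, div_mul_cancel₀ _ hω'.ne', ENNReal.ofReal_toReal hVt]

theorem mainTheorem6 (n : ℕ) (hn : 2 ≤ n) (p : ℝ) (hp : p < 0)
    (α : ℝ) (hα : 1 < α) (hαp : -p / ((n : ℝ) - 1) < α) :
    ∃ rbar : ℝ, 0 < rbar ∧ ∀ r : ℝ, 0 < r → r < rbar →
      ∀ c : ℕ → Rn n, (∀ h, c h ≠ 0) → (∀ h, c h ∈ ball (0 : Rn n) 1) →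
        ball (0 : Rn n) 1 ⊆ closure (range c) →
        ∃ σ : Equiv.Perm ℕ, IsGreedyRearrangement α r c σ ∧
          HasFinitePerimeter (ballUnion r c σ) ∧
          (0 : Rn n) ∈ frontier (densityPoints (ballUnion r c σ) 1) \
            reducedBoundary (ballUnion r c σ) ∧
          ∃ R : ℝ, 0 < R ∧
            volume (ballUnion r c σ) = volume (ball (0 : Rn n) R) ∧
            weightedPerimeter p (ballUnion r c σ) <
              weightedPerimeter p (ball (0 : Rn n) R) := by
  have hn0 : n ≠ 0 := by omega
  have hα0 : 0 < α := by linarith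
  have hn1 : (0 : ℝ) < n - 1 := by
    have : (2 : ℝ) ≤ n := by exact_mod_cast hn
    linarith
  obtain ⟨C, hC, hupper⟩ := exists_weightedPerimeter_iUnion_ball_le hn
  obtain ⟨k, hk, hlower⟩ := exists_le_weightedPerimeter_ball hn
  set β : ℝ := (n - 1) + p / α with hβ
  have hβ0 : 0 < β := by
    rw [div_lt_iff₀ hn1] at hαp
    have : -(n - 1 : ℝ) < p / α := by
      rw [lt_div_iff₀ hα0]
      linarith
    linarith
  -- γ is the gain β - (p+n-1) over the exponent of the comparison ball.
  set γ : ℝ := p / α - p with hγ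
  have hγ0 : 0 < γ := by
    have : p < p / α := by
      rw [lt_div_iff₀ hα0]
      nlinarith
    linarith
  set δ : ℝ := 1 - (2 : ℝ) ^ (-(β / n)) with hδ
  have hδ0 : 0 < δ := sub_pos.2 (two_rpow_neg_lt_one hn0 hβ0)
  have hlim : Tendsto (fun r : ℝ => C * δ⁻¹ * r ^ γ) (𝓝 0) (𝓝 0) := by
    have h1 : Tendsto (fun r : ℝ => C * δ⁻¹ * r ^ γ) (𝓝 0) (𝓝 (C * δ⁻¹ * 0 ^ γ)) :=
      ((Real.continuous_rpow_const hγ0.le).tendsto 0).const_mul _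
    rwa [Real.zero_rpow hγ0.ne', mul_zero] at h1
  obtain ⟨ε, hε, hsmall⟩ := Metric.eventually_nhds_iff.1
    (hlim.eventually_lt_const (show 0 < k * 2 ^ p by positivity))
  -- The bound r < 2^{-α} puts all thresholds 2r_i^{1/α} below 1, so that B_1 contains admissible
  -- points; it also gives r < 1.
  refine ⟨min ε ((2 : ℝ) ^ (-α)), lt_min hε (by positivity), fun r hr hrbar c hc0 _ hcd => ?_⟩
  have hr2 : r < (2 : ℝ) ^ (-α) := hrbar.trans_le (min_le_right _ _)
  have hr1 : r < 1 := hr2.trans (Real.rpow_lt_one_of_one_lt_of_neg one_lt_two (by linarith))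
  have hcmp : C * δ⁻¹ * r ^ γ < k * 2 ^ p := hsmall (by
    rw [Real.dist_eq, sub_zero, abs_of_pos hr]
    exact hrbar.trans_le (min_le_left _ _))
  have hthr : ∀ i, (2 * radius n r i ^ α⁻¹) ^ α = 2 ^ α * radius n r i := fun i => by
    have hi := radius_pos (n := n) hr i
    rw [Real.mul_rpow two_pos.le (by positivity), ← Real.rpow_mul hi.le, inv_mul_cancel₀ hα0.ne',
      Real.rpow_one]
  have hiff : ∀ i h, (2 : ℝ) ^ α * radius n r i < ‖c h‖ ^ α ↔
      2 * radius n r i ^ α⁻¹ < ‖c h‖ := fun i h => by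
    have hi := radius_pos (n := n) hr i
    rw [← hthr, Real.rpow_lt_rpow_iff (by positivity) (norm_nonneg _) hα0]
  obtain ⟨σ, hσ⟩ := exists_greedy_perm
    (P := fun i h => (2 : ℝ) ^ α * radius n r i < ‖c h‖ ^ α) (fun i => by
      have hi := radius_pos (n := n) hr i
      simp_rw [hiff]
      refine infinite_setOf_lt_norm hn0 hcd (by positivity) ?_
      rw [← Real.rpow_lt_rpow_iff (by positivity) zero_le_one hα0, hthr, Real.one_rpow]
      have h1 := (radius_le (n := n) hr i).trans_lt hr2
      rw [Real.rpow_neg two_pos.le, lt_inv_comm₀ hi (by positivity)] at h1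
      calc _ < (2 : ℝ) ^ α * ((2 : ℝ) ^ α)⁻¹ := by
            gcongr
            exact (lt_inv_comm₀ (by positivity) hi).1 h1
        _ = 1 := mul_inv_cancel₀ (by positivity))
    (fun h => by
      have h1 : Tendsto (fun i => (2 : ℝ) ^ α * radius n r i) atTop (𝓝 0) := by
        simpa using (tendsto_radius hn0 hr).const_mul ((2 : ℝ) ^ α)
      have h2 : 0 < ‖c h‖ ^ α := Real.rpow_pos_of_pos (norm_pos_iff.2 (hc0 h)) α
      exact eventually_atTop.1 (h1.eventually_lt_const h2))
  have hrpos := radius_pos (n := n) hr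
  have hq : ∀ i, 2 * radius n r i ^ α⁻¹ < ‖c (σ i)‖ := fun i => (hiff i _).1 (hσ i).1.2
  have hsum : Summable fun i => radius n r i ^ (n - 1) := by
    have h := (hasSum_radius_rpow hn0 hr (β := (n - 1 : ℕ))
      (by exact_mod_cast (by omega : 0 < n - 1))).summable
    simpa only [Real.rpow_natCast] using h
  have hEo : IsOpen (ballUnion r c σ) := isOpen_iUnion fun i => isOpen_ball
  have hdens : (0 : Rn n) ∈ densityPoints (ballUnion r c σ) 0 :=
    zero_mem_densityPoints_zero hn0 hr hr1.le hα hq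
  refine ⟨σ, hσ, hasFinitePerimeter_iUnion_ball _ hrpos hsum, ⟨⟨?_, ?_⟩, ?_⟩, ?_⟩
  · have hsub : range c ⊆ ballUnion r c σ := by
      rintro _ ⟨h, rfl⟩
      refine mem_iUnion.2 ⟨σ.symm h, ?_⟩
      rw [Equiv.apply_symm_apply]
      exact mem_ball_self (hrpos _)
    exact closure_mono (hsub.trans hEo.subset_densityPoints_one) (hcd (mem_ball_self one_pos))
  · intro h
    exact zero_ne_one (tendsto_nhds_unique hdens (interior_subset h))
  · exact notMem_reducedBoundary_of_density_zero hn hEo.measurableSet hdens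
  · obtain ⟨R, hrR, hR2, hvol⟩ := exists_radius_volume_eq hn0 hr fun i => c (σ i)
    have hR : 0 < R := hr.trans_le hrR
    refine ⟨R, hR, hvol, ?_⟩
    have hsphere : ∀ i, ∀ x ∈ sphere (c (σ i)) (radius n r i), radius n r i ^ α⁻¹ ≤ ‖x‖ := by
      intro i x hx
      have h1 : radius n r i ≤ radius n r i ^ α⁻¹ := by
        conv_lhs => rw [← Real.rpow_one (radius n r i)]
        exact Real.rpow_le_rpow_of_exponent_ge (hrpos i) ((radius_le hr i).trans hr1.le)
          (inv_le_one_of_one_le₀ hα.le)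
      rw [mem_sphere, dist_eq_norm'] at hx
      have h2 : ‖c (σ i)‖ ≤ ‖x‖ + ‖c (σ i) - x‖ := norm_le_insert' _ _
      linarith [hq i]
    have hup := hupper p hp (fun i => c (σ i)) (radius n r) (fun i => radius n r i ^ α⁻¹) hrpos hsum
      (fun i => Real.rpow_pos_of_pos (hrpos i) _) hsphere
    have hcast : ((n - 1 : ℕ) : ℝ) = n - 1 := by
      rw [Nat.cast_sub (by omega), Nat.cast_one]
    have hterm : ∀ i, C * radius n r i ^ (n - 1) * (radius n r i ^ α⁻¹) ^ p =
        C * radius n r i ^ β := fun i => by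
      rw [mul_assoc, ← Real.rpow_natCast, ← Real.rpow_mul (hrpos i).le,
        ← Real.rpow_add (hrpos i), hcast, hβ]
      congr 3
      rw [div_eq_inv_mul]
    simp_rw [hterm] at hup
    have hS := (hasSum_radius_rpow hn0 hr hβ0).mul_left C
    rw [← ENNReal.ofReal_tsum_of_nonneg
      (fun i => mul_nonneg hC.le (Real.rpow_nonneg (hrpos i).le _)) hS.summable, hS.tsum_eq] at hup
    refine hup.trans_lt (lt_of_lt_of_le ?_ (hlower p R hR))
    refine (ENNReal.ofReal_lt_ofReal_iff (by positivity)).2 ?_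
    have h1 : r ^ β = r ^ γ * (r ^ p * r ^ (n - 1)) := by
      rw [← Real.rpow_natCast, ← Real.rpow_add hr, ← Real.rpow_add hr, hcast]
      congr 1
      rw [hβ, hγ]
      ring
    -- As p < 0, the lower bound for R^p comes from R ≤ 2r; that for R^{n-1} comes from R ≥ r.
    have h2 : 2 ^ p * r ^ p ≤ R ^ p := by
      rw [← Real.mul_rpow two_pos.le hr.le]
      exact Real.rpow_le_rpow_of_nonpos hR hR2 hp.le
    calc C * (r ^ β * δ⁻¹) = C * δ⁻¹ * r ^ γ * (r ^ p * r ^ (n - 1)) := by rw [h1]; ring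
      _ < k * 2 ^ p * (r ^ p * r ^ (n - 1)) := by gcongr
      _ = k * (2 ^ p * r ^ p * r ^ (n - 1)) := by ring
      _ ≤ k * (R ^ p * R ^ (n - 1)) := by gcongr
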